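/- **Setting.** For a real $2\times2$ matrix $M$ let $\rho(M)$ be the maximum of the moduli of its (complex) eigenvalues, and for a pair $\mathsf B=\{B_0,B_1\}$ of real $2\times 2$ matrices let $\varrho(\mathsf B):=\lim_{n\to\infty}\max\{\|B_{i_n}\cdots B_{i_1}\|^{1/n}: i_j\in\{0,1\}\}$ be the joint spectral radius (for any operator norm). For a finite word $u=u_1\cdots u_m$ over $\{0,1\}$ put $|u|:=m$ and $\mathcal B(u):=B_{u_m}\cdots B_{u_1}$. An infinite word $x=(x_i)_{i\ge1}\in\{0,1\}^{\mathbb N}$ is *weakly extremal* for $\mathsf B$ if $\|B_{x_n}\cdots B_{x_1}\|^{1/n}\to\varrho(\mathsf B)$. A finite word is *balanced* if any two of its subwords (blocks of consecutive letters) of equal length have numbers of $1$s differing by at most one, and *cyclically balanced* if all of its cyclic permutations (itself included) are balanced. For $\gamma\in[0,1]$ let $X_\gamma$ be the set of all $x\in\{0,1\}^{\mathbb N}$ such that for some $\delta\in\mathbb R$ either $x_n=\lfloor\gamma(n+1)+\delta\rfloor-\lfloor\gamma n+\delta\rfloor$ for all $n\ge 1$, or $x_n=\lceil\gamma(n+1)+\delta\rceil-\lceil\gamma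 n+\delta\rceil$ for all $n\ge 1$. Let $A_0,A_1$ be real $2\times 2$ matrices, write $\mathcal A(u):=A_{u_m}\cdots A_{u_1}$, and for $\alpha\ge0$ let $\mathsf A_\alpha:=\{A_0,\alpha A_1\}$, with corresponding word products $\mathcal A_\alpha(u)$, and $\varrho(\alpha):=\varrho(\mathsf A_\alpha)$. Assume: 1. $A_0$ and $A_1$ are (entrywise) non-negative, invertible, have positive trace, and have no common invariant subspace other than $\{0\}$ and $\mathbb R^2$; 2. if a finite word $u$ is not of the form $0^n$ or $1^n$ with $n\ge 0$, then all entries of $\mathcal A(u)$ are positive; and let $\mathfrak r:[0,\infty)\to[0,1]$ be a function such that, for every $\alpha\ge0$: 3. every $x\in X_{\mathfrak r(\alpha)}$ is weakly extremal for $\mathsf A_\alpha$; 4. if $x\in\{0,1\}^{\mathbb N}$ is weakly extremal for $\mathsf A_\alpha$, then $\frac1n\#\{1\le i\le n: x_i=1\}\to\mathfrak r(\alpha)$; 5. $\rho(\mathcal A_\alpha(u))<\varrho(\alpha)^{|u|}$ for every finite word $u$ that is not cyclically balanced. **Theorem.** Let $\gamma\in(0,1)$ be irrational, with continued fraction coefficients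 $a_1,a_2,\dots$, i.e. $\gamma=\cfrac1{a_1+\cfrac1{a_2+\cdots}}$, let $p_n/q_n$ be its $n$th convergent in lowest terms for $n\geq 1$, and let $p_0:=0$, $q_0:=1$. Define finite words by $s_{-1}:=1$, $s_0:=0$, $s_1:=s_0^{a_1-1}s_{-1}$ and $s_{n+1}:=s_n^{a_{n+1}}s_{n-1}$ for $n\ge1$, where products and powers denote concatenation, and set $\rho_n:=\rho(\mathcal A(s_n))$ for $n\ge-1$. Then $\{\alpha\geq 0:\mathfrak r(\alpha)=\gamma\}$ consists of a single point $\alpha_\gamma$, we have $\alpha_\gamma>0$, and $$\alpha_\gamma=\lim_{n\to\infty}\left(\frac{\rho_n^{q_{n+1}}}{\rho_{n+1}^{q_n}}\right)^{(-1)^n}=\frac1{\rho(A_1)}\prod_{n=0}^\infty\left(\frac{\rho_n^{a_{n+1}}\rho_{n-1}}{\rho_{n+1}}\right)^{(-1)^nq_n},$$ where the limit exists and the infinite product is the limit of its partial products $\prod_{n=0}^{N-1}$ as $N\to\infty$. -/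

import Mathlib

open scoped NNReal Topology

noncomputable section

namespace DevilStaircase

/-- Real two by two matrices. -/
abbrev Mat := Matrix (Fin 2) (Fin 2) ℝ

/-- Finite words over the alphabet `{0, 1}`. -/
abbrev Word := List (Fin 2)

/-- Infinite words over `{0, 1}`; the entry `x i` is the letter written `x_{i+1}` when
letters are counted from `1`. -/
abbrev InfWord := ℕ → Fin 2

/-- The `k`-th power of a finite word: the concatenation of `k` copies. -/
def wordPow (u : Word) (k : ℕ) : Word := (List.replicate k u).flatten

/-- A finite word is balanced if any two subwords (blocks of consecutive letters) of equal
length have numbers of `1`s differing by at most one. -/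
def Balanced (u : Word) : Prop :=
  ∀ v w : Word, v <:+: u → w <:+: u → v.length = w.length →
    |(v.count 1 : ℤ) - (w.count 1 : ℤ)| ≤ 1

/-- A word is cyclically balanced if all of its cyclic permutations (itself included) are
balanced. -/
def CyclicallyBalanced (u : Word) : Prop :=
  ∀ v : Word, u ~r v → Balanced v

/-- The spectral radius: the maximum of the moduli of the complex eigenvalues. -/
def rho (M : Mat) : ℝ :=
  (spectralRadius ℂ (M.map ((↑) : ℝ → ℂ))).toReal

/-- For `u = u_1 u_2 ⋯ u_m`, the product `B_{u_m} ⋯ B_{u_2} B_{u_1}`. -/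
def wordProd (B : Fin 2 → Mat) (u : Word) : Mat := (u.reverse.map B).prod

/-- The product `B_{x_n} ⋯ B_{x_1}` along the first `n` letters of an infinite word. -/
def prefixProd (B : Fin 2 → Mat) (x : InfWord) (n : ℕ) : Mat :=
  wordProd B (List.ofFn fun i : Fin n => x i)

section Norm

-- The norm on matrices is the operator norm of the sup norm on `ℝ²`.
attribute [local instance] Matrix.linftyOpNormedAddCommGroup

/-- The joint spectral radius of the pair `B`: the limit of the maximum of
`‖B_{i_n} ⋯ B_{i_1}‖^{1/n}` over all words of length `n`. -/
def jointSpectralRadius (B : Fin 2 → Mat) : ℝ :=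
  Filter.limUnder Filter.atTop fun n : ℕ =>
    ⨆ w : Fin n → Fin 2, ‖wordProd B (List.ofFn w)‖ ^ (1 / (n : ℝ))

/-- The infinite word `x` is weakly extremal for the pair `B`. -/
def WeaklyExtremal (B : Fin 2 → Mat) (x : InfWord) : Prop :=
  Filter.Tendsto (fun n : ℕ => ‖prefixProd B x n‖ ^ (1 / (n : ℝ))) Filter.atTop
    (𝓝 (jointSpectralRadius B))

end Norm

/-- The pair `(A_0, α A_1)`. -/
def scaledPair (A : Fin 2 → Mat) (α : ℝ≥0) : Fin 2 → Mat := ![A 0, (α : ℝ) • A 1]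

/-- The set `X_γ` of Sturmian infinite words with `1`-ratio `γ`. The entry `x n` is the letter
in position `n + 1`. -/
def sturmianSet (γ : ℝ) : Set InfWord :=
  {x | ∃ δ : ℝ,
    (∀ n : ℕ, ((x n : ℕ) : ℤ) =
      ⌊γ * (((n + 1 : ℕ) : ℝ) + 1) + δ⌋ - ⌊γ * ((n + 1 : ℕ) : ℝ) + δ⌋) ∨
    (∀ n : ℕ, ((x n : ℕ) : ℤ) =
      ⌈γ * (((n + 1 : ℕ) : ℝ) + 1) + δ⌉ - ⌈γ * ((n + 1 : ℕ) : ℝ) + δ⌉)}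

/-- The technical hypotheses on a pair of matrices. -/
structure TechnicalHypotheses (A : Fin 2 → Mat) : Prop where
  nonneg : ∀ k i j, 0 ≤ A k i j
  invertible : ∀ k, IsUnit (A k)
  trace_pos : ∀ k, 0 < (A k).trace
  no_common_invariant_subspace : ∀ V : Submodule ℝ (Fin 2 → ℝ),
    (∀ k, ∀ v ∈ V, (A k).mulVec v ∈ V) → V = ⊥ ∨ V = ⊤
  mixed_word_pos : ∀ u : Word,
    (∀ n : ℕ, u ≠ List.replicate n 0 ∧ u ≠ List.replicate n 1) →
      ∀ i j, 0 < wordProd A u i j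

/-- `r` is a `1`-ratio function of the pair `A`. -/
structure IsOneRatioFunction (A : Fin 2 → Mat) (r : ℝ≥0 → Set.Icc (0 : ℝ) 1) : Prop where
  weaklyExtremal : ∀ α : ℝ≥0, ∀ x ∈ sturmianSet (r α), WeaklyExtremal (scaledPair A α) x
  ratio : ∀ α : ℝ≥0, ∀ x : InfWord, WeaklyExtremal (scaledPair A α) x →
    Filter.Tendsto
      (fun n : ℕ => (((Finset.range n).filter fun i => x i = 1).card : ℝ) / (n : ℝ))
      Filter.atTop (𝓝 (r α : ℝ))
  not_balanced_lt : ∀ α : ℝ≥0, ∀ u : Word, ¬ CyclicallyBalanced u →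
    rho (wordProd (scaledPair A α) u) < jointSpectralRadius (scaledPair A α) ^ u.length

/-- The continued fraction coefficient `a_n` of `γ = [a_1, a_2, …] ∈ (0, 1)`, for `n ≥ 1`
(the value at `0` is a placeholder). The entries of `partDens` are natural numbers, so taking
the floor only changes the type. -/
def cfCoeff (γ : ℝ) : ℕ → ℕ
  | 0 => 0
  | n + 1 => ⌊((GenContFract.of γ).partDens.get? n).getD 0⌋₊

/-- The denominator `q_n` of the `n`-th convergent of `γ` in lowest terms. -/
def cfDen (γ : ℝ) (n : ℕ) : ℕ := (Real.convergent γ n).den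

/-- The words `s_{-1}, s_0, s_1, …` attached to the coefficients `a_1, a_2, …`, with the index
shifted by one: `stdWord a k` is `s_{k-1}`. -/
def stdWord (a : ℕ → ℕ) : ℕ → Word
  | 0 => [1]
  | 1 => [0]
  | 2 => wordPow [0] (a 1 - 1) ++ [1]
  | n + 3 => wordPow (stdWord a (n + 2)) (a (n + 2)) ++ stdWord a (n + 1)

/-- The spectral radius `ρ_{k-1}` of the product along the word `s_{k-1}`, for the continued
fraction coefficients of `γ`; thus `rhoSeq A γ (n + 1)` is `ρ_n`. -/
def rhoSeq (A : Fin 2 → Mat) (γ : ℝ) (k : ℕ) : ℝ :=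
  rho (wordProd A (stdWord (cfCoeff γ) k))

end DevilStaircase

end

noncomputable section

namespace DevilStaircase

/-! ### Continued fractions -/

/-! Write α = e^t. The quantity `logCross` at n is the value of t at which the length-normalised
spectral radii of the scaled products along s_n and s_{n+1} coincide; its exponential is the nth
term of the limit formula, and its increments telescope to the infinite product.

The sequence `logCross` converges for every pair satisfying `TechnicalHypotheses`, whatever the
one-ratio function. Its increment is ±q_{n+1} times the defect a_{n+2} log ρ_{n+1} + log ρ_n - log
ρ_{n+2}. The ratio |det|/per is submultiplicative on non-negative matrices, so the product along
s_{n+1} contracts the positive cone by a factor exponentially small in q_{n+1}. The left Perron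
vectors for s_n and s_{n+1} both lie in the image of that product, hence nearly agree, and the
defect is O(κ^{q_{n+1}}) with κ < 1 (`rho_mul_pow_comparison`, `rhoSeq_comparison`,
`exists_tendsto_logCross`).

If the ratio at e^t is γ, the standard words are prefixes of an extremal Sturmian word (`pre_mech`).
So h_n, the gap between `logJSR` at t and the normalised log spectral radius along s_n, is
eventually non-negative and tends to 0. Its increments are (-1)^n (`logCross` - t)/(q_n q_{n+1}). If
`logCross` - t had a non-zero limit, then along one parity h would strictly increase to 0 through
non-negative values, which is impossible (`eq_zero_of_alternating_increments`). This forces t to be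
the limit and gives uniqueness (`eq_of_ratio_eq`).

Existence of t is an intermediate value argument. The sets where the ratio is at least γ, or at most
γ, are closed: nearly extremal words for nearby parameters are glued into an extremal one
(`isClosed_ratio`). They are non-empty because the ratio is a subgradient of `logJSR`, which is at
least c and at least c + t. Connectedness of ℝ yields a common point (`exists_ratio_eq`). -/

/-- The numerators of the convergents, by recursion. -/
def contNum (a : ℕ → ℕ) : ℕ → ℕ
  | 0 => 0
  | 1 => 1
  | n + 2 => a (n + 2) * contNum a (n + 1) + contNum a n

/-- The denominators of the convergents, by recursion. -/
def contDen (a : ℕ → ℕ) : ℕ → ℕ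
  | 0 => 1
  | 1 => a 1
  | n + 2 => a (n + 2) * contDen a (n + 1) + contDen a n

theorem contNum_mul_contDen_sub (a : ℕ → ℕ) (n : ℕ) :
    (contNum a (n + 1) : ℤ) * contDen a n - contNum a n * contDen a (n + 1) = (-1) ^ n := by
  induction n with
  | zero => simp [contNum, contDen]
  | succ n ih =>
    rw [pow_succ, ← ih]
    simp only [contNum, contDen]
    push_cast
    ring

theorem contDen_pos {a : ℕ → ℕ} (ha : ∀ n, 1 ≤ a (n + 1)) : ∀ n, 0 < contDen a n
  | 0 => Nat.one_pos
  | 1 => ha 0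
  | n + 2 => by
    have := contDen_pos ha n
    simp only [contDen]
    omega

/-- The orbit of the fractional part under the Gauss map. -/
def gaussOrbit (v : ℝ) : ℕ → ℝ
  | 0 => Int.fract v
  | n + 1 => Int.fract (gaussOrbit v n)⁻¹

theorem gaussOrbit_succ' (v : ℝ) (n : ℕ) :
    gaussOrbit v (n + 1) = gaussOrbit (Int.fract v)⁻¹ n := by
  induction n with
  | zero => rfl
  | succ n ih => rw [gaussOrbit, ih, gaussOrbit]

theorem irrational_fract {v : ℝ} (hv : Irrational v) : Irrational (Int.fract v) :=
  hv.sub_intCast _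

theorem irrational_gaussOrbit {v : ℝ} (hv : Irrational v) (n : ℕ) :
    Irrational (gaussOrbit v n) := by
  induction n with
  | zero => exact irrational_fract hv
  | succ n ih => exact irrational_fract ih.inv

theorem gaussOrbit_pos {v : ℝ} (hv : Irrational v) (n : ℕ) : 0 < gaussOrbit v n := by
  have h := (irrational_gaussOrbit hv n).ne_zero
  have : 0 ≤ gaussOrbit v n := by
    cases n <;> exact Int.fract_nonneg _
  exact lt_of_le_of_ne this h.symm

theorem gaussOrbit_lt_one (v : ℝ) (n : ℕ) : gaussOrbit v n < 1 := by
  cases n <;> exact Int.fract_lt_one _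

theorem get?_of_s {v : ℝ} (hv : Irrational v) (n : ℕ) :
    (GenContFract.of v).s.get? n = some ⟨1, (⌊(gaussOrbit v n)⁻¹⌋ : ℝ)⟩ := by
  induction n generalizing v with
  | zero => exact GenContFract.of_s_head (irrational_fract hv).ne_zero
  | succ n ih =>
    rw [GenContFract.of_s_succ, ih (irrational_fract hv).inv, gaussOrbit_succ']

theorem cfCoeff_succ {v : ℝ} (hv : Irrational v) (n : ℕ) :
    cfCoeff v (n + 1) = ⌊(gaussOrbit v n)⁻¹⌋₊ := by
  have := GenContFract.partDen_eq_s_b (get?_of_s hv n)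
  simp only [cfCoeff, this, Option.getD_some]
  rw [← natCast_floor_eq_intCast_floor (inv_nonneg.2 (gaussOrbit_pos hv n).le)]
  exact Nat.floor_natCast _

theorem cast_cfCoeff_succ {v : ℝ} (hv : Irrational v) (n : ℕ) :
    (cfCoeff v (n + 1) : ℝ) = ⌊(gaussOrbit v n)⁻¹⌋ := by
  rw [cfCoeff_succ hv, natCast_floor_eq_intCast_floor (inv_nonneg.2 (gaussOrbit_pos hv n).le)]

theorem one_le_cfCoeff {v : ℝ} (hv : Irrational v) (n : ℕ) : 1 ≤ cfCoeff v (n + 1) := by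
  rw [cfCoeff_succ hv, Nat.one_le_floor_iff]
  exact (one_le_inv₀ (gaussOrbit_pos hv n)).2 (gaussOrbit_lt_one v n).le

theorem of_s_get? {v : ℝ} (hv : Irrational v) (n : ℕ) :
    (GenContFract.of v).s.get? n = some ⟨1, (cfCoeff v (n + 1) : ℝ)⟩ := by
  rw [cast_cfCoeff_succ hv, get?_of_s hv]

theorem dens_eq_contDen {v : ℝ} (hv : Irrational v) :
    ∀ n, (GenContFract.of v).dens n = contDen (cfCoeff v) n
  | 0 => by simp [contDen]
  | 1 => by
    rw [GenContFract.first_den_eq (of_s_get? hv 0)]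
    simp [contDen]
  | n + 2 => by
    rw [GenContFract.dens_recurrence (of_s_get? hv (n + 1)) (dens_eq_contDen hv n)
      (dens_eq_contDen hv (n + 1))]
    simp [contDen]

theorem nums_eq_contNum {v : ℝ} (hv : Irrational v) (h0 : 0 < v) (h1 : v < 1) :
    ∀ n, (GenContFract.of v).nums n = contNum (cfCoeff v) n
  | 0 => by
    simp [contNum, Int.floor_eq_zero_iff, h0.le, h1]
  | 1 => by
    have : ⌊v⌋ = 0 := Int.floor_eq_zero_iff.2 ⟨h0.le, h1⟩
    rw [GenContFract.first_num_eq (of_s_get? hv 0)]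
    simp [contNum, this]
  | n + 2 => by
    rw [GenContFract.nums_recurrence (of_s_get? hv (n + 1)) (nums_eq_contNum hv h0 h1 n)
      (nums_eq_contNum hv h0 h1 (n + 1))]
    simp [contNum]

/-- The determinant identity is a Bézout relation up to sign, so the recursive fractions are already
in lowest terms. -/
theorem cfDen_eq_contDen {v : ℝ} (hv : Irrational v) (h0 : 0 < v) (h1 : v < 1) (n : ℕ) :
    cfDen v n = contDen (cfCoeff v) n := by
  have hpos := contDen_pos (one_le_cfCoeff hv) n
  have h : Real.convergent v n = (contNum (cfCoeff v) n : ℚ) / (contDen (cfCoeff v) n : ℚ) := by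
    have := Real.convs_eq_convergent v n
    rw [GenContFract.conv_eq_num_div_den, nums_eq_contNum hv h0 h1, dens_eq_contDen hv] at this
    apply Rat.cast_injective (α := ℝ)
    push_cast
    exact this.symm
  have hcop : Nat.Coprime (contNum (cfCoeff v) n) (contDen (cfCoeff v) n) := by
    rw [← Nat.isCoprime_iff_coprime]
    have hd := contNum_mul_contDen_sub (cfCoeff v) n
    refine ⟨-(-1) ^ n * contDen (cfCoeff v) (n + 1), (-1) ^ n * contNum (cfCoeff v) (n + 1), ?_⟩
    have h2 : ((-1 : ℤ) ^ n) * (-1) ^ n = 1 := by rw [← mul_pow]; simp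
    linear_combination (-1) ^ n * hd + h2
  have h' : Real.convergent v n =
      ((contNum (cfCoeff v) n : ℤ) : ℚ) / ((contDen (cfCoeff v) n : ℤ) : ℚ) := by
    rw [h]; simp
  have := Rat.den_div_eq_of_coprime (a := (contNum (cfCoeff v) n : ℤ))
    (b := (contDen (cfCoeff v) n : ℤ)) (by exact_mod_cast hpos) (by simpa using hcop)
  rw [← h'] at this
  exact_mod_cast this

/-- Passing from one approximation error to the next multiplies it by minus a point of the Gauss
orbit, which is positive; hence the signs alternate. -/
theorem contDen_mul_sub_contNum {v : ℝ} (hv : Irrational v) (h0 : 0 < v) (h1 : v < 1) (n : ℕ) :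
    0 < (-1) ^ n * (contDen (cfCoeff v) n * v - contNum (cfCoeff v) n) ∧
    contDen (cfCoeff v) (n + 1) * v - contNum (cfCoeff v) (n + 1) =
      -gaussOrbit v (n + 1) * (contDen (cfCoeff v) n * v - contNum (cfCoeff v) n) := by
  induction n with
  | zero =>
    have hf : gaussOrbit v 0 = v := Int.fract_eq_self.2 ⟨h0.le, h1⟩
    refine ⟨by simpa [contDen, contNum] using h0, ?_⟩
    have := cast_cfCoeff_succ hv 0
    simp only [contDen, contNum, gaussOrbit, Int.fract]
    simp only [gaussOrbit, zero_add, Int.fract] at this hf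
    rw [this, hf]
    field_simp
    simp only [CharP.cast_eq_zero]
    ring
  | succ n ih =>
    obtain ⟨ih1, ih2⟩ := ih
    have hy := gaussOrbit_pos hv (n + 1)
    refine ⟨?_, ?_⟩
    · rw [ih2, pow_succ]
      have := mul_pos hy ih1
      linarith
    · set y := gaussOrbit v (n + 1) with hyd
      have e : gaussOrbit v (n + 1 + 1) = y⁻¹ - cfCoeff v (n + 1 + 1) := by
        rw [cast_cfCoeff_succ hv, gaussOrbit, Int.fract]
      rw [e]
      have h3 : y⁻¹ * (contDen (cfCoeff v) (n + 1) * v - contNum (cfCoeff v) (n + 1)) =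
          -(contDen (cfCoeff v) n * v - contNum (cfCoeff v) n) := by
        rw [ih2]; field_simp
      have h4 : (contDen (cfCoeff v) (n + 1 + 1) : ℝ) =
        cfCoeff v (n + 1 + 1) * contDen (cfCoeff v) (n + 1) + contDen (cfCoeff v) n := by
        simp [contDen]
      have h5 : (contNum (cfCoeff v) (n + 1 + 1) : ℝ) =
        cfCoeff v (n + 1 + 1) * contNum (cfCoeff v) (n + 1) + contNum (cfCoeff v) n := by
        simp [contNum]
      rw [h4, h5]
      linear_combination h3

/-! ### Prefixes of mechanical words -/

/-- The prefix of length `n` of an infinite word. -/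
def pre (x : InfWord) (n : ℕ) : Word := List.ofFn fun i : Fin n => x i

@[simp] theorem length_pre (x : InfWord) (n : ℕ) : (pre x n).length = n := by simp [pre]

@[simp] theorem pre_zero (x : InfWord) : pre x 0 = [] := by simp [pre]

theorem pre_add (x : InfWord) (m n : ℕ) :
    pre x (m + n) = pre x m ++ pre (fun i => x (m + i)) n := by
  simp [pre, List.ofFn_add]

theorem pre_succ (x : InfWord) (n : ℕ) : pre x (n + 1) = pre x n ++ [x n] := by
  rw [pre_add]; simp [pre]

theorem pre_congr {x y : InfWord} {n : ℕ} (h : ∀ i < n, x i = y i) : pre x n = pre y n := by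
  simp only [pre]
  congr 1
  funext i
  exact h i i.2

theorem count_pre (x : InfWord) (n : ℕ) :
    (pre x n).count 1 = ((Finset.range n).filter fun i => x i = 1).card := by
  induction n with
  | zero => simp
  | succ n ih =>
    rw [pre_succ, List.count_append, ih, Finset.range_add_one, Finset.filter_insert]
    by_cases h : x n = 1 <;> simp [h]

theorem wordPow_succ (u : Word) (k : ℕ) : wordPow u (k + 1) = u ++ wordPow u k := by
  simp [wordPow, List.replicate_succ]

theorem pre_eq_wordPow {x : InfWord} {q r : ℕ} (k : ℕ)
    (h : ∀ i, i + q < k * q + r → x (i + q) = x i) :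
    pre x (k * q + r) = wordPow (pre x q) k ++ pre x r := by
  induction k with
  | zero => simp [wordPow]
  | succ k ih =>
    have e : (k + 1) * q + r = q + (k * q + r) := by ring
    rw [e] at h ⊢
    rw [pre_add, wordPow_succ, List.append_assoc, ← ih fun i hi => h i (by omega)]
    congr 1
    refine pre_congr fun i hi => ?_
    rw [add_comm]
    exact h i (by omega)

/-- The lower mechanical word of slope `θ` and intercept `0`. -/
def mech (θ : ℝ) : InfWord := fun i =>
  if ⌊θ * (((i + 1 : ℕ) : ℝ) + 1)⌋ - ⌊θ * ((i + 1 : ℕ) : ℝ)⌋ = 1 then 1 else 0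

theorem mech_mem_sturmianSet {θ : ℝ} (h0 : 0 ≤ θ) (h1 : θ ≤ 1) : mech θ ∈ sturmianSet θ := by
  refine ⟨0, Or.inl fun n => ?_⟩
  simp only [add_zero]
  set s : ℝ := θ * ((n + 1 : ℕ) : ℝ) with hs
  have e : θ * (((n + 1 : ℕ) : ℝ) + 1) = s + θ := by rw [hs]; ring
  have l : ⌊s⌋ ≤ ⌊s + θ⌋ := Int.floor_le_floor (by linarith)
  have u : ⌊s + θ⌋ ≤ ⌊s⌋ + 1 := by
    rw [← Int.floor_add_one]
    exact Int.floor_le_floor (by linarith)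
  simp only [mech, e, ← hs]
  split_ifs with h
  · simp [h]
  · have : ⌊s + θ⌋ - ⌊s⌋ = 0 := by omega
    simp [this]

/-- If the two floors disagreed, an integer point would lie on the wrong side of the line of slope
v. As the convergents p/q and p'/q' have determinant ±1, this would write i as q' times a positive
integer plus q times a non-negative one, contradicting i < q'. -/
theorem floor_mul_add_contDen {v : ℝ} (hv : Irrational v) (h0 : 0 < v) (h1 : v < 1) (n i : ℕ)
    (hi : 1 ≤ i) (hi' : i < contDen (cfCoeff v) (n + 1)) :
    ⌊v * ((i + contDen (cfCoeff v) n : ℕ) : ℝ)⌋ = ⌊v * (i : ℝ)⌋ + contNum (cfCoeff v) n := by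
  have hdet := contNum_mul_contDen_sub (cfCoeff v) n
  have hs := (contDen_mul_sub_contNum hv h0 h1 n).1
  have hs' := (contDen_mul_sub_contNum hv h0 h1 (n + 1)).1
  have hq := contDen_pos (one_le_cfCoeff hv) n
  have hq' := contDen_pos (one_le_cfCoeff hv) (n + 1)
  generalize contDen (cfCoeff v) n = q at *
  generalize contDen (cfCoeff v) (n + 1) = q' at *
  generalize contNum (cfCoeff v) n = p at *
  generalize contNum (cfCoeff v) (n + 1) = p' at *
  have hiR : (1 : ℝ) ≤ i := by exact_mod_cast hi
  have hqR : (0 : ℝ) < q := by exact_mod_cast hq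
  have hqR' : (0 : ℝ) < q' := by exact_mod_cast hq'
  have hfl := Int.floor_le (v * i)
  have hfl' := Int.lt_floor_add_one (v * i)
  have hne : (⌊v * (i : ℝ)⌋ : ℝ) ≠ v * i := fun h =>
    (hv.mul_natCast (show i ≠ 0 by omega)).ne_int _ h.symm
  have hfl2 : (⌊v * (i : ℝ)⌋ : ℝ) < v * i := lt_of_le_of_ne hfl hne
  rw [Int.floor_eq_iff]
  push_cast
  generalize ⌊v * (i : ℝ)⌋ = j at *
  rcases Nat.even_or_odd n with he | ho
  · rw [he.neg_one_pow] at hs hdet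
    rw [he.add_one.neg_one_pow] at hs'
    refine ⟨by nlinarith, ?_⟩
    by_contra! hcon
    have A : 1 ≤ (q : ℤ) * (j + 1) - p * i := by
      have : (0 : ℝ) < q * (j + 1) - p * i := by nlinarith
      have : (0 : ℤ) < q * (j + 1) - p * i := by exact_mod_cast this
      omega
    have B : 1 ≤ (p' : ℤ) * (i + q) - q' * (j + 1 + p) := by
      have : (0 : ℝ) < p' * (i + q) - q' * (j + 1 + p) := by
        have : (0:ℝ) < (p' - q' * v) * (i + q) := mul_pos (by linarith) (by linarith)
        nlinarith
      have : (0 : ℤ) < p' * (i + q) - q' * (j + 1 + p) := by exact_mod_cast this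
      omega
    have B' : 0 ≤ (p' : ℤ) * i - q' * (j + 1) := by linarith
    have E : (i : ℤ) = q' * (q * (j + 1) - p * i) + q * (p' * i - q' * (j + 1)) := by
      linear_combination (-(i : ℤ)) * hdet
    have C1 : (q' : ℤ) * 1 ≤ q' * (q * (j + 1) - p * i) :=
      mul_le_mul_of_nonneg_left A (by positivity)
    have C2 : 0 ≤ (q : ℤ) * (p' * i - q' * (j + 1)) := mul_nonneg (by positivity) B'
    omega
  · rw [ho.neg_one_pow] at hs hdet
    rw [ho.add_one.neg_one_pow] at hs'
    refine ⟨?_, by nlinarith⟩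
    by_contra! hcon
    have A : 1 ≤ (p : ℤ) * i - q * j := by
      have : (0 : ℝ) < p * i - q * j := by nlinarith
      have : (0 : ℤ) < p * i - q * j := by exact_mod_cast this
      omega
    have B : 1 ≤ (q' : ℤ) * (j + p) - p' * (i + q) := by
      have : (0 : ℝ) < q' * (j + p) - p' * (i + q) := by
        have : (0:ℝ) < (q' * v - p') * (i + q) := mul_pos (by linarith) (by linarith)
        nlinarith
      have : (0 : ℤ) < q' * (j + p) - p' * (i + q) := by exact_mod_cast this
      omega
    have B' : 0 ≤ (q' : ℤ) * j - p' * i := by linarith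
    have E : (i : ℤ) = q' * (p * i - q * j) + q * (q' * j - p' * i) := by
      linear_combination (i : ℤ) * hdet
    have C1 : (q' : ℤ) * 1 ≤ q' * (p * i - q * j) :=
      mul_le_mul_of_nonneg_left A (by positivity)
    have C2 : 0 ≤ (q : ℤ) * (q' * j - p' * i) := mul_nonneg (by positivity) B'
    omega

/-- The letter at index i compares the floors at i + 1 and i + 2; both have to stay below q_{n+1}.
-/
theorem mech_add_contDen {v : ℝ} (hv : Irrational v) (h0 : 0 < v) (h1 : v < 1) (n i : ℕ)
    (hi : i + 2 < contDen (cfCoeff v) (n + 1)) :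
    mech v (i + contDen (cfCoeff v) n) = mech v i := by
  have e1 := floor_mul_add_contDen hv h0 h1 n (i + 1) (by omega) (by omega)
  have e2 := floor_mul_add_contDen hv h0 h1 n (i + 2) (by omega) (by omega)
  have r1 : (((i + contDen (cfCoeff v) n + 1 : ℕ) : ℝ) + 1) =
      ((i + 2 + contDen (cfCoeff v) n : ℕ) : ℝ) := by push_cast; ring
  have r2 : i + contDen (cfCoeff v) n + 1 = i + 1 + contDen (cfCoeff v) n := by ring
  have r3 : (((i + 1 : ℕ) : ℝ) + 1) = ((i + 2 : ℕ) : ℝ) := by push_cast; ring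
  simp only [mech]
  rw [r1, r2, e1, e2, r3, add_sub_add_right_eq_sub]

theorem two_le_contDen {a : ℕ → ℕ} (ha : ∀ n, 1 ≤ a (n + 1)) (n : ℕ) : 2 ≤ contDen a (n + 2) := by
  have h1 := contDen_pos ha n
  have h2 : 1 * 1 ≤ a (n + 2) * contDen a (n + 1) :=
    Nat.mul_le_mul (ha (n + 1)) (contDen_pos ha (n + 1))
  simp only [contDen]
  omega

theorem pre_mech_one {v : ℝ} (hv : Irrational v) (h0 : 0 < v) (h1 : v < 1) :
    pre (mech v) (contDen (cfCoeff v) 1) = stdWord (cfCoeff v) 2 := by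
  have hD := contDen_mul_sub_contNum hv h0 h1 0
  have hD1 := (contDen_mul_sub_contNum hv h0 h1 1).1
  have hy1 := gaussOrbit_lt_one v 1
  have ha := one_le_cfCoeff hv 0
  simp only [contDen, contNum, zero_add, Nat.cast_one, one_mul, Nat.cast_zero, sub_zero] at *
  obtain ⟨b, hb⟩ : ∃ b, cfCoeff v 1 = b + 1 := ⟨cfCoeff v 1 - 1, by omega⟩
  have hlow : (cfCoeff v 1 : ℝ) * v < 1 := by linarith
  have hup : 1 < (cfCoeff v 1 : ℝ) * v + v := by nlinarith [hD.2]
  simp only [stdWord, hb, Nat.add_sub_cancel]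
  rw [hb] at hlow hup
  have hz : ∀ j : ℕ, j ≤ b + 1 → ⌊v * (j : ℝ)⌋ = 0 := fun j hj => by
    rw [Int.floor_eq_zero_iff]
    have : (j : ℝ) ≤ (b + 1 : ℕ) := by exact_mod_cast hj
    exact ⟨by positivity, by nlinarith⟩
  rw [pre_succ]
  congr 1
  · have : ∀ i < b, mech v i = (0 : Fin 2) := fun i hi => by
      have e : (((i + 1 : ℕ) : ℝ) + 1) = ((i + 2 : ℕ) : ℝ) := by push_cast; ring
      simp only [mech]
      rw [e, hz _ (by omega), hz _ (by omega)]
      simp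
    rw [pre_congr (y := fun _ => 0) this]
    simp [pre, wordPow]
  · have e : ⌊v * (((b + 1 : ℕ) : ℝ) + 1)⌋ = 1 := by
      rw [Int.floor_eq_iff]
      push_cast at *
      constructor <;> nlinarith
    simp only [mech]
    rw [e, hz _ le_rfl]
    simp

/-- A separate base case: s_0 = 0 is not a prefix of the mechanical word when a_1 = 1, so the final
letter is computed directly. -/
theorem pre_mech_two {v : ℝ} (hv : Irrational v) (h0 : 0 < v) (h1 : v < 1) :
    pre (mech v) (contDen (cfCoeff v) 2) = stdWord (cfCoeff v) 3 := by
  have hq2 := two_le_contDen (one_le_cfCoeff hv) 0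
  have hq3 := two_le_contDen (one_le_cfCoeff hv) 1
  have hq1 := contDen_pos (one_le_cfCoeff hv) 1
  have e : contDen (cfCoeff v) 2 = cfCoeff v 2 * contDen (cfCoeff v) 1 + 1 := rfl
  have hlast : mech v (cfCoeff v 2 * contDen (cfCoeff v) 1) = 0 := by
    have hs := floor_mul_add_contDen hv h0 h1 2 1 le_rfl hq3
    have hp := (contDen_mul_sub_contNum hv h0 h1 2).1
    have hf : ⌊v * ((1 : ℕ) : ℝ)⌋ = 0 := by
      rw [Int.floor_eq_zero_iff]
      simpa using ⟨h0.le, h1⟩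
    rw [hf, zero_add, add_comm] at hs
    have h2 : ⌊v * (contDen (cfCoeff v) 2 : ℝ)⌋ = contNum (cfCoeff v) 2 := by
      have := Int.lt_floor_add_one (v * ((contDen (cfCoeff v) 2 + 1 : ℕ) : ℝ))
      rw [hs] at this
      rw [Int.floor_eq_iff]
      push_cast at *
      constructor <;> nlinarith
    simp only [mech, ← e]
    rw [h2, ← Nat.cast_add_one, hs]
    simp
  have hper := pre_eq_wordPow (x := mech v) (q := contDen (cfCoeff v) 1) (r := 0) (cfCoeff v 2)
    fun i hi => mech_add_contDen hv h0 h1 1 i (by rw [e]; omega)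
  rw [e, pre_succ, hlast, ← add_zero (cfCoeff v 2 * _), hper, pre_mech_one hv h0 h1]
  simp [stdWord]

/-- The standard words are prefixes of the mechanical word. -/
theorem pre_mech {v : ℝ} (hv : Irrational v) (h0 : 0 < v) (h1 : v < 1) :
    ∀ n, pre (mech v) (contDen (cfCoeff v) (n + 1)) = stdWord (cfCoeff v) (n + 2)
  | 0 => pre_mech_one hv h0 h1
  | 1 => pre_mech_two hv h0 h1
  | n + 2 => by
    -- A period of at least 2 keeps every index used within the range i + 2 < q_{n+3} where the
    -- shift is controlled.
    have hq := two_le_contDen (one_le_cfCoeff hv) n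
    have e : contDen (cfCoeff v) (n + 2 + 1) =
      cfCoeff v (n + 3) * contDen (cfCoeff v) (n + 2) + contDen (cfCoeff v) (n + 1) := rfl
    have hper := pre_eq_wordPow (x := mech v) (q := contDen (cfCoeff v) (n + 2))
      (r := contDen (cfCoeff v) (n + 1)) (cfCoeff v (n + 3))
      fun i hi => mech_add_contDen hv h0 h1 (n + 2) i (by rw [e]; omega)
    rw [e, hper, pre_mech hv h0 h1 (n + 1), pre_mech hv h0 h1 n]
    rfl

theorem length_stdWord {v : ℝ} (hv : Irrational v) (h0 : 0 < v) (h1 : v < 1) (n : ℕ) :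
    (stdWord (cfCoeff v) (n + 2)).length = contDen (cfCoeff v) (n + 1) := by
  rw [← pre_mech hv h0 h1, length_pre]

theorem count_wordPow (u : Word) (k : ℕ) : (wordPow u k).count 1 = k * u.count 1 := by
  induction k with
  | zero => simp [wordPow]
  | succ k ih => rw [wordPow_succ, List.count_append, ih]; ring

theorem count_stdWord (a : ℕ → ℕ) : ∀ n, (stdWord a (n + 1)).count 1 = contNum a n
  | 0 => by simp [stdWord, contNum]
  | 1 => by simp [stdWord, contNum, count_wordPow]
  | n + 2 => by
    simp only [stdWord, contNum, List.count_append, count_wordPow, count_stdWord a n,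
      count_stdWord a (n + 1)]

/-! ### Perron theory of non-negative two by two matrices -/

/-- `toReal` sends ⊤ to 0, so finiteness must come from a bound on the spectrum before eigenvalues
can be compared with it. -/
theorem spectralRadius_toReal_bounds (M : Matrix (Fin 2) (Fin 2) ℂ) {c : ℝ} (hc : 0 ≤ c)
    (h : ∀ z ∈ spectrum ℂ M, ‖z‖ ≤ c) : (∀ z ∈ spectrum ℂ M,
      ‖z‖ ≤ (spectralRadius ℂ M).toReal) ∧ (spectralRadius ℂ M).toReal ≤ c := by
  have e : ∀ z : ℂ, ENNReal.ofReal ‖z‖ = (‖z‖₊ : ENNReal) := fun z => by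
    rw [← coe_nnnorm, ENNReal.ofReal_coe_nnreal]
  have hle : spectralRadius ℂ M ≤ ENNReal.ofReal c := by
    refine iSup₂_le fun z hz => ?_
    rw [← e]
    exact ENNReal.ofReal_le_ofReal (h z hz)
  refine ⟨fun z hz => ?_, ENNReal.toReal_le_of_le_ofReal hc hle⟩
  have : ENNReal.ofReal ‖z‖ ≤ spectralRadius ℂ M := by
    rw [e]
    exact le_iSup₂ (f := fun (k : ℂ) (_ : k ∈ spectrum ℂ M) => (‖k‖₊ : ENNReal)) z hz
  rw [← ENNReal.toReal_ofReal (norm_nonneg z)]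
  exact ENNReal.toReal_mono (ne_top_of_le_ne_top ENNReal.ofReal_ne_top hle) this

/-- The larger root of the characteristic polynomial of a matrix. -/
def perron (M : Mat) : ℝ :=
  (M 0 0 + M 1 1 + √((M 0 0 - M 1 1) ^ 2 + 4 * (M 0 1 * M 1 0))) / 2

theorem mem_spectrum_iff (M : Mat) (z : ℂ) :
    z ∈ spectrum ℂ (M.map ((↑) : ℝ → ℂ)) ↔
      (z - M 0 0) * (z - M 1 1) - M 0 1 * M 1 0 = 0 := by
  rw [spectrum.mem_iff, Matrix.isUnit_iff_isUnit_det, isUnit_iff_ne_zero, not_not,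
    Matrix.det_fin_two]
  simp [Matrix.algebraMap_matrix_apply]

theorem rho_eq_perron {M : Mat} (hM : ∀ i j, 0 ≤ M i j) : rho M = perron M := by
  have hbc : 0 ≤ M 0 1 * M 1 0 := mul_nonneg (hM _ _) (hM _ _)
  have h0 := hM 0 0
  have h1 := hM 1 1
  set s := √((M 0 0 - M 1 1) ^ 2 + 4 * (M 0 1 * M 1 0)) with hs
  have hss : s ^ 2 = (M 0 0 - M 1 1) ^ 2 + 4 * (M 0 1 * M 1 0) :=
    Real.sq_sqrt (by positivity)
  have hs0 : 0 ≤ s := Real.sqrt_nonneg _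
  have hp : perron M = (M 0 0 + M 1 1 + s) / 2 := rfl
  have hfac : ∀ z : ℂ, (z - M 0 0) * (z - M 1 1) - M 0 1 * M 1 0 =
      (z - ((M 0 0 + M 1 1 + s) / 2 : ℝ)) * (z - ((M 0 0 + M 1 1 - s) / 2 : ℝ)) := fun z => by
    have : (s : ℂ) ^ 2 = ((M 0 0 : ℂ) - M 1 1) ^ 2 + 4 * (M 0 1 * M 1 0) := by exact_mod_cast hss
    push_cast
    linear_combination (1 / 4 : ℂ) * this
  have hle : ∀ z ∈ spectrum ℂ (M.map ((↑) : ℝ → ℂ)), ‖z‖ ≤ perron M := fun z hz => by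
    rw [mem_spectrum_iff, hfac, mul_eq_zero, sub_eq_zero, sub_eq_zero] at hz
    rcases hz with rfl | rfl <;> rw [Complex.norm_real, Real.norm_eq_abs, hp, abs_le] <;>
      constructor <;> linarith
  have key := spectralRadius_toReal_bounds _ (c := perron M) (by rw [hp]; positivity) hle
  refine le_antisymm key.2 ?_
  have := key.1 (perron M : ℂ) (by rw [mem_spectrum_iff, hfac, hp]; simp)
  rw [Complex.norm_real] at this
  exact (le_abs_self _).trans this

theorem half_trace_le_rho {M : Mat} (hM : ∀ i j, 0 ≤ M i j) : (M 0 0 + M 1 1) / 2 ≤ rho M := by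
  rw [rho_eq_perron hM, perron]
  have := Real.sqrt_nonneg ((M 0 0 - M 1 1) ^ 2 + 4 * (M 0 1 * M 1 0))
  linarith

theorem rho_pos {M : Mat} (hM : ∀ i j, 0 ≤ M i j) (ht : 0 < M.trace) : 0 < rho M := by
  rw [Matrix.trace_fin_two] at ht
  linarith [half_trace_le_rho hM]

theorem perron_char (M : Mat) (hbc : 0 ≤ M 0 1 * M 1 0) :
    (perron M - M 0 0) * (perron M - M 1 1) = M 0 1 * M 1 0 := by
  have hss := Real.sq_sqrt (show 0 ≤ (M 0 0 - M 1 1) ^ 2 + 4 * (M 0 1 * M 1 0) by positivity)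
  rw [perron]
  linear_combination (1 / 4 : ℝ) * hss

theorem perron_gt (M : Mat) (hbc : 0 < M 0 1 * M 1 0) : M 0 0 < perron M := by
  have : |M 0 0 - M 1 1| < √((M 0 0 - M 1 1) ^ 2 + 4 * (M 0 1 * M 1 0)) :=
    Real.lt_sqrt_of_sq_lt (by rw [sq_abs]; linarith)
  rw [perron]
  linarith [le_abs_self (M 0 0 - M 1 1)]

/-- The entries of a positive right eigenvector. -/
theorem exists_right_eigenvector {M : Mat} (hM : ∀ i j, 0 < M i j) :
    ∃ w : Fin 2 → ℝ, (∀ i, 0 < w i) ∧ M.mulVec w = rho M • w := by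
  have hbc : 0 < M 0 1 * M 1 0 := mul_pos (hM _ _) (hM _ _)
  rw [rho_eq_perron fun i j => (hM i j).le]
  have h1 := perron_char M hbc.le
  have h2 := perron_gt M hbc
  refine ⟨![M 0 1, perron M - M 0 0], fun i => ?_, ?_⟩
  · fin_cases i
    · exact hM 0 1
    · simpa using h2
  · ext i
    fin_cases i
    · simp [Matrix.mulVec, dotProduct, Fin.sum_univ_two]; ring
    · simp [Matrix.mulVec, dotProduct, Fin.sum_univ_two]; linarith

/-- A positive left eigenvector. -/
theorem exists_left_eigenvector {M : Mat} (hM : ∀ i j, 0 < M i j) :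
    ∃ p : Fin 2 → ℝ, (∀ i, 0 < p i) ∧ M.vecMul p = rho M • p := by
  have hbc : 0 < M 0 1 * M 1 0 := mul_pos (hM _ _) (hM _ _)
  rw [rho_eq_perron fun i j => (hM i j).le]
  have h1 := perron_char M hbc.le
  have h2 := perron_gt M hbc
  refine ⟨![M 1 0, perron M - M 0 0], fun i => ?_, ?_⟩
  · fin_cases i
    · exact hM 1 0
    · simpa using h2
  · ext i
    fin_cases i
    · simp [Matrix.vecMul, dotProduct, Fin.sum_univ_two]; ring
    · simp [Matrix.vecMul, dotProduct, Fin.sum_univ_two]; linarith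

/-- Half of Collatz–Wielandt: pairing with a positive right eigenvector turns the coordinatewise
inequality into a scalar one. -/
theorem rho_le_of_vecMul_le {M : Mat} (hM : ∀ i j, 0 < M i j) {p : Fin 2 → ℝ}
    (hp : ∀ i, 0 < p i) {c : ℝ} (h : ∀ i, M.vecMul p i ≤ c * p i) : rho M ≤ c := by
  obtain ⟨w, hw, hMw⟩ := exists_right_eigenvector hM
  have e : p ⬝ᵥ M.mulVec w = M.vecMul p ⬝ᵥ w := Matrix.dotProduct_mulVec _ _ _
  rw [hMw] at e
  simp only [dotProduct, Fin.sum_univ_two, Pi.smul_apply, smul_eq_mul] at e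
  have hpos : 0 < p 0 * w 0 + p 1 * w 1 :=
    add_pos (mul_pos (hp 0) (hw 0)) (mul_pos (hp 1) (hw 1))
  have a0 := mul_le_mul_of_nonneg_right (h 0) (hw 0).le
  have a1 := mul_le_mul_of_nonneg_right (h 1) (hw 1).le
  refine le_of_mul_le_mul_right ?_ hpos
  linarith

theorem le_rho_of_le_vecMul {M : Mat} (hM : ∀ i j, 0 < M i j) {p : Fin 2 → ℝ}
    (hp : ∀ i, 0 < p i) {c : ℝ} (h : ∀ i, c * p i ≤ M.vecMul p i) : c ≤ rho M := by
  obtain ⟨w, hw, hMw⟩ := exists_right_eigenvector hM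
  have e : p ⬝ᵥ M.mulVec w = M.vecMul p ⬝ᵥ w := Matrix.dotProduct_mulVec _ _ _
  rw [hMw] at e
  simp only [dotProduct, Fin.sum_univ_two, Pi.smul_apply, smul_eq_mul] at e
  have hpos : 0 < p 0 * w 0 + p 1 * w 1 :=
    add_pos (mul_pos (hp 0) (hw 0)) (mul_pos (hp 1) (hw 1))
  have a0 := mul_le_mul_of_nonneg_right (h 0) (hw 0).le
  have a1 := mul_le_mul_of_nonneg_right (h 1) (hw 1).le
  refine le_of_mul_le_mul_right ?_ hpos
  linarith

/-! ### Permanents and the contraction of the projective action -/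

/-- The permanent of a two by two matrix. -/
def per (M : Mat) : ℝ := M 0 0 * M 1 1 + M 0 1 * M 1 0

/-- The difference of the two sides is twice the sum of the products `a` and `b`. Since det is
multiplicative, |det|/per becomes a submultiplicative contraction coefficient. -/
theorem per_mul_le {M N : Mat} (hM : ∀ i j, 0 ≤ M i j) (hN : ∀ i j, 0 ≤ N i j) :
    per M * per N ≤ per (M * N) := by
  have a : 0 ≤ M 0 0 * M 1 0 * (N 0 0 * N 0 1) :=
    mul_nonneg (mul_nonneg (hM _ _) (hM _ _)) (mul_nonneg (hN _ _) (hN _ _))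
  have b : 0 ≤ M 0 1 * M 1 1 * (N 1 0 * N 1 1) :=
    mul_nonneg (mul_nonneg (hM _ _) (hM _ _)) (mul_nonneg (hN _ _) (hN _ _))
  simp only [per, Matrix.mul_apply, Fin.sum_univ_two]
  linarith

theorem per_nonneg {M : Mat} (hM : ∀ i j, 0 ≤ M i j) : 0 ≤ per M :=
  add_nonneg (mul_nonneg (hM _ _) (hM _ _)) (mul_nonneg (hM _ _) (hM _ _))

theorem abs_det_mul_le {M N : Mat} (hM : ∀ i j, 0 ≤ M i j) (hN : ∀ i j, 0 ≤ N i j) {b b' : ℝ}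
    (hb : 0 ≤ b) (h : |M.det| ≤ b * per M) (hb' : 0 ≤ b') (h' : |N.det| ≤ b' * per N) :
    |(M * N).det| ≤ b * b' * per (M * N) := by
  rw [Matrix.det_mul, abs_mul]
  calc |M.det| * |N.det| ≤ (b * per M) * (b' * per N) :=
        mul_le_mul h h' (abs_nonneg _) (mul_nonneg hb (per_nonneg hM))
    _ = b * b' * (per M * per N) := by ring
    _ ≤ _ := mul_le_mul_of_nonneg_left (per_mul_le hM hN) (mul_nonneg hb hb')

theorem abs_det_pow_le {M : Mat} (hM : ∀ i j, 0 ≤ M i j) {b : ℝ}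
    (hb : 0 ≤ b) (h : |M.det| ≤ b * per M) (k : ℕ) :
    (∀ i j, 0 ≤ (M ^ k) i j) ∧ |(M ^ k).det| ≤ b ^ k * per (M ^ k) := by
  induction k with
  | zero =>
    refine ⟨fun i j => ?_, by simp [per]⟩
    rw [pow_zero, Matrix.one_apply]
    split_ifs <;> norm_num
  | succ k ih =>
    refine ⟨fun i j => ?_, ?_⟩
    · rw [pow_succ, Matrix.mul_apply]
      exact Finset.sum_nonneg fun l _ => mul_nonneg (ih.1 _ _) (hM _ _)
    · rw [pow_succ, pow_succ b]
      exact abs_det_mul_le ih.1 hM (pow_nonneg hb k) ih.2 hb h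

theorem exists_abs_det_le {M : Mat} (hM : ∀ i j, 0 < M i j) {q : ℕ} (hq : 1 ≤ q) :
    ∃ κ : ℝ, 0 < κ ∧ κ < 1 ∧ |M.det| ≤ κ ^ q * per M := by
  have h1 : 0 < M 0 0 * M 1 1 := mul_pos (hM _ _) (hM _ _)
  have h2 : 0 < M 0 1 * M 1 0 := mul_pos (hM _ _) (hM _ _)
  have hper : 0 < per M := by unfold per; linarith
  have hlt : |M.det| < per M := by
    rw [Matrix.det_fin_two, abs_lt]
    unfold per
    constructor <;> linarith
  set b := |M.det| / per M with hb
  have hb1 : b < 1 := (div_lt_one hper).2 hlt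
  have hb0 : 0 ≤ b := by positivity
  have hqR : (1 : ℝ) ≤ q := by exact_mod_cast hq
  have hq0 : (0 : ℝ) < q := by linarith
  have hd0 : 0 < (1 - b) / (2 * q) := div_pos (by linarith) (by linarith)
  have hd1 : (1 - b) / (2 * q) < 1 := by
    rw [div_lt_one (by linarith)]; linarith
  -- Bernoulli's inequality gives κ^q ≥ 1 - (1 - b)/2 ≥ b for this κ, so no qth root is needed.
  refine ⟨1 - (1 - b) / (2 * q), by linarith, by linarith, ?_⟩
  have hB := one_add_mul_le_pow (a := -((1 - b) / (2 * q))) (by linarith) q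
  have hbe : b ≤ (1 - (1 - b) / (2 * q)) ^ q := by
    refine le_trans ?_ (hB.trans_eq (by ring))
    have : (q : ℝ) * -((1 - b) / (2 * q)) = -((1 - b) / 2) := by field_simp
    rw [this]
    linarith
  calc |M.det| = b * per M := by rw [hb]; field_simp
    _ ≤ _ := mul_le_mul_of_nonneg_right hbe hper.le

/-- The determinant bound says that the diagonal and antidiagonal products of M are within a factor
K of each other. Expanding the bilinear expressions, log K bounds the Hilbert diameter of the image
of the cone. -/
theorem cross_ratio_le {M : Mat} (hM : ∀ i j, 0 ≤ M i j) {b K : ℝ} (hb0 : 0 ≤ b)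
    (hb1 : b < 1) (h : |M.det| ≤ b * per M) (hK : K = (1 + b) / (1 - b)) {y z : Fin 2 → ℝ}
    (hy : ∀ i, 0 ≤ y i) (hz : ∀ i, 0 ≤ z i) :
    M.vecMul y 0 * M.vecMul z 1 ≤ K * (M.vecMul y 1 * M.vecMul z 0) := by
  have hK' : K * (1 - b) = 1 + b := by
    rw [hK]; field_simp [show (1 - b) ≠ 0 by linarith]
  have hK1 : 1 ≤ K := by
    rw [hK, le_div_iff₀ (by linarith)]; linarith
  rw [Matrix.det_fin_two, abs_le] at h
  unfold per at h
  have hd : 0 < 1 - b := by linarith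
  have c1 : M 0 0 * M 1 1 ≤ K * (M 0 1 * M 1 0) := by
    refine le_of_mul_le_mul_left ?_ hd
    calc (1 - b) * (M 0 0 * M 1 1) ≤ (1 + b) * (M 0 1 * M 1 0) := by linarith [h.2]
      _ = _ := by rw [← hK']; ring
  have c2 : M 0 1 * M 1 0 ≤ K * (M 0 0 * M 1 1) := by
    refine le_of_mul_le_mul_left ?_ hd
    calc (1 - b) * (M 0 1 * M 1 0) ≤ (1 + b) * (M 0 0 * M 1 1) := by linarith [h.1]
      _ = _ := by rw [← hK']; ring
  have c3 : M 0 0 * M 0 1 ≤ K * (M 0 0 * M 0 1) :=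
    le_mul_of_one_le_left (mul_nonneg (hM _ _) (hM _ _)) hK1
  have c4 : M 1 0 * M 1 1 ≤ K * (M 1 0 * M 1 1) :=
    le_mul_of_one_le_left (mul_nonneg (hM _ _) (hM _ _)) hK1
  have d1 := mul_le_mul_of_nonneg_left c1 (mul_nonneg (hy 0) (hz 1))
  have d2 := mul_le_mul_of_nonneg_left c2 (mul_nonneg (hy 1) (hz 0))
  have d3 := mul_le_mul_of_nonneg_left c3 (mul_nonneg (hy 0) (hz 0))
  have d4 := mul_le_mul_of_nonneg_left c4 (mul_nonneg (hy 1) (hz 1))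
  simp only [Matrix.vecMul, dotProduct, Fin.sum_univ_two]
  linarith

theorem vecMul_pow_eq {M : Mat} {p : Fin 2 → ℝ} {c : ℝ} (h : M.vecMul p = c • p) (k : ℕ) :
    (M ^ k).vecMul p = c ^ k • p := by
  induction k with
  | zero => simp
  | succ k ih => rw [pow_succ', ← Matrix.vecMul_vecMul, h, Matrix.smul_vecMul, ih, smul_smul,
      pow_succ']

theorem vecMul_comparison {Q : Mat} (hQ : ∀ i j, 0 ≤ Q i j) {p q : Fin 2 → ℝ} {c K : ℝ}
    (hK : 1 ≤ K) (hp : ∀ i, 0 < p i) (hq : ∀ i, 0 < q i) (hqQ : Q.vecMul q = c • q)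
    (h1 : p 0 * q 1 ≤ K * (p 1 * q 0)) (h2 : p 1 * q 0 ≤ K * (p 0 * q 1)) (i : Fin 2) :
    Q.vecMul p i ≤ K * c * p i ∧ c * p i ≤ K * Q.vecMul p i := by
  have e := congrFun hqQ i
  simp only [Matrix.vecMul, dotProduct, Fin.sum_univ_two, Pi.smul_apply, smul_eq_mul] at *
  have hpq : ∀ j, p j * q i ≤ K * (p i * q j) ∧ p i * q j ≤ K * (p j * q i) := by
    intro j
    have s : ∀ k, p k * q k ≤ K * (p k * q k) := fun k =>
      le_mul_of_one_le_left (mul_pos (hp k) (hq k)).le hK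
    fin_cases i <;> fin_cases j <;> simp only [Fin.zero_eta, Fin.mk_one] <;>
      first | exact ⟨s _, s _⟩ | exact ⟨h1, h2⟩ | exact ⟨h2, h1⟩
  have a0 := mul_le_mul_of_nonneg_left (hpq 0).1 (hQ 0 i)
  have a1 := mul_le_mul_of_nonneg_left (hpq 1).1 (hQ 1 i)
  have b0 := mul_le_mul_of_nonneg_left (hpq 0).2 (hQ 0 i)
  have b1 := mul_le_mul_of_nonneg_left (hpq 1).2 (hQ 1 i)
  have e' : K * p i * (q 0 * Q 0 i + q 1 * Q 1 i) = K * p i * (c * q i) := by rw [e]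
  have e'' : p i * (q 0 * Q 0 i + q 1 * Q 1 i) = p i * (c * q i) := by rw [e]
  constructor
  · refine le_of_mul_le_mul_right ?_ (hq i)
    linarith
  · refine le_of_mul_le_mul_right ?_ (hq i)
    linarith

/-- If a power of `Q` factors through `P` on the right then the spectral radius of `Q * P ^ k` is
close to the product of the spectral radii. -/
theorem rho_mul_pow_comparison {P Q Y : Mat} (hP : ∀ i j, 0 < P i j) (hQ : ∀ i j, 0 < Q i j)
    (hY : ∀ i j, 0 ≤ Y i j) {m : ℕ} (hQm : Q ^ m = Y * P) {b : ℝ} (hb0 : 0 ≤ b) (hb1 : b < 1)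
    (hdet : |P.det| ≤ b * per P) (k : ℕ) (hpos : ∀ i j, 0 < (Q * P ^ k) i j) :
    rho (Q * P ^ k) ≤ (1 + b) / (1 - b) * (rho P ^ k * rho Q) ∧
      rho P ^ k * rho Q ≤ (1 + b) / (1 - b) * rho (Q * P ^ k) := by
  obtain ⟨p, hp, hpP⟩ := exists_left_eigenvector hP
  obtain ⟨q, hq, hqQ⟩ := exists_left_eigenvector hQ
  set K := (1 + b) / (1 - b) with hK
  have hK1 : 1 ≤ K := by rw [hK, le_div_iff₀ (by linarith)]; linarith
  have hrP : 0 < rho P := rho_pos (fun i j => (hP i j).le) (by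
    rw [Matrix.trace_fin_two]; exact add_pos (hP _ _) (hP _ _))
  have hrQ : 0 < rho Q := rho_pos (fun i j => (hQ i j).le) (by
    rw [Matrix.trace_fin_two]; exact add_pos (hQ _ _) (hQ _ _))
  have hz : ∀ i, 0 ≤ Y.vecMul q i := fun i => by
    simp only [Matrix.vecMul, dotProduct]
    exact Finset.sum_nonneg fun l _ => mul_nonneg (hq l).le (hY _ _)
  -- The factorisation places q, like p, in the image of P up to a scalar, so p and q are K-close
  -- projectively. Then p is almost a left eigenvector of Q, and Collatz–Wielandt applies to p.
  have hzP : P.vecMul (Y.vecMul q) = rho Q ^ m • q := by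
    rw [Matrix.vecMul_vecMul, ← hQm, vecMul_pow_eq hqQ]
  have hD : 0 < rho P * rho Q ^ m := by positivity
  have c1 := cross_ratio_le (fun i j => (hP i j).le) hb0 hb1 hdet hK (fun i => (hp i).le) hz
  have c2 := cross_ratio_le (fun i j => (hP i j).le) hb0 hb1 hdet hK hz (fun i => (hp i).le)
  rw [hzP, hpP] at c1 c2
  simp only [Pi.smul_apply, smul_eq_mul] at c1 c2
  have h1 : p 0 * q 1 ≤ K * (p 1 * q 0) := le_of_mul_le_mul_left (by linarith) hD
  have h2 : p 1 * q 0 ≤ K * (p 0 * q 1) := le_of_mul_le_mul_left (by linarith) hD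
  have key := vecMul_comparison (fun i j => (hQ i j).le) hK1 hp hq hqQ h1 h2
  have hPk : ∀ i j, 0 ≤ (P ^ k) i j :=
    (abs_det_pow_le (fun i j => (hP i j).le) hb0 hdet k).1
  have e : ∀ i, (Q * P ^ k).vecMul p i =
      Q.vecMul p 0 * (P ^ k) 0 i + Q.vecMul p 1 * (P ^ k) 1 i := fun i => by
    rw [← Matrix.vecMul_vecMul]
    simp only [Matrix.vecMul, dotProduct, Fin.sum_univ_two]
  have e' : ∀ i, p 0 * (P ^ k) 0 i + p 1 * (P ^ k) 1 i = rho P ^ k * p i := fun i => by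
    have := congrFun (vecMul_pow_eq hpP k) i
    simpa only [Matrix.vecMul, dotProduct, Fin.sum_univ_two, Pi.smul_apply, smul_eq_mul] using this
  constructor
  · refine rho_le_of_vecMul_le hpos hp fun i => ?_
    rw [e]
    have a0 := mul_le_mul_of_nonneg_right (key 0).1 (hPk 0 i)
    have a1 := mul_le_mul_of_nonneg_right (key 1).1 (hPk 1 i)
    calc _ ≤ K * rho Q * (p 0 * (P ^ k) 0 i + p 1 * (P ^ k) 1 i) := by linarith
      _ = _ := by rw [e']; ring
  · have : rho P ^ k * rho Q / K ≤ rho (Q * P ^ k) := by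
      refine le_rho_of_le_vecMul hpos hp fun i => ?_
      rw [e, div_mul_eq_mul_div, div_le_iff₀ (by linarith)]
      have a0 := mul_le_mul_of_nonneg_right (key 0).2 (hPk 0 i)
      have a1 := mul_le_mul_of_nonneg_right (key 1).2 (hPk 1 i)
      calc rho P ^ k * rho Q * p i = rho Q * (p 0 * (P ^ k) 0 i + p 1 * (P ^ k) 1 i) := by
            rw [e']; ring
        _ ≤ _ := by linarith
    rw [div_le_iff₀ (by linarith)] at this
    linarith

open Filter

/-! ### The operator norm on words -/

section Norm

attribute [local instance] Matrix.linftyOpNormedAddCommGroup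

/-- The operator norm of the sup norm on `ℝ²`. -/
def nrm (M : Mat) : ℝ := ‖M‖

theorem nrm_nonneg (M : Mat) : 0 ≤ nrm M := norm_nonneg M

theorem nrm_pos {M : Mat} (h : M ≠ 0) : 0 < nrm M := norm_pos_iff.2 h

theorem nrm_zero : nrm 0 = 0 := norm_zero

theorem nrm_mul_le (M N : Mat) : nrm (M * N) ≤ nrm M * nrm N := Matrix.linfty_opNorm_mul M N

theorem nrm_mulVec_le (M : Mat) (v : Fin 2 → ℝ) : ‖M.mulVec v‖ ≤ nrm M * ‖v‖ :=
  Matrix.linfty_opNorm_mulVec M v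

theorem nrm_eq (M : Mat) : nrm M = max (|M 0 0| + |M 0 1|) (|M 1 0| + |M 1 1|) := by
  rw [nrm, Matrix.linfty_opNorm_def]
  simp [Finset.univ_fin2]

theorem jointSpectralRadius_eq (B : Fin 2 → Mat) :
    jointSpectralRadius B = limUnder atTop fun n : ℕ =>
      ⨆ w : Fin n → Fin 2, nrm (wordProd B (List.ofFn w)) ^ (1 / (n : ℝ)) := rfl

theorem weaklyExtremal_iff (B : Fin 2 → Mat) (x : InfWord) :
    WeaklyExtremal B x ↔ Tendsto (fun n : ℕ => nrm (wordProd B (pre x n)) ^ (1 / (n : ℝ))) atTop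
      (𝓝 (jointSpectralRadius B)) := Iff.rfl

end Norm

theorem nrm_smul (c : ℝ) (M : Mat) : nrm (c • M) = |c| * nrm M := by
  simp only [nrm_eq, Matrix.smul_apply, smul_eq_mul, abs_mul]
  rw [mul_max_of_nonneg _ _ (abs_nonneg c)]
  ring_nf

/-- The sum of the entries. -/
def entrySum (M : Mat) : ℝ := M 0 0 + M 0 1 + (M 1 0 + M 1 1)

theorem nrm_le_entrySum {M : Mat} (hM : ∀ i j, 0 ≤ M i j) : nrm M ≤ entrySum M := by
  have := hM 0 0; have := hM 0 1; have := hM 1 0; have := hM 1 1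
  rw [nrm_eq, abs_of_nonneg (hM 0 0), abs_of_nonneg (hM 0 1), abs_of_nonneg (hM 1 0),
    abs_of_nonneg (hM 1 1), entrySum]
  apply max_le <;> linarith

theorem entrySum_le {M : Mat} (hM : ∀ i j, 0 ≤ M i j) : entrySum M ≤ 2 * nrm M := by
  rw [nrm_eq, abs_of_nonneg (hM 0 0), abs_of_nonneg (hM 0 1), abs_of_nonneg (hM 1 0),
    abs_of_nonneg (hM 1 1), entrySum]
  linarith [le_max_left (M 0 0 + M 0 1) (M 1 0 + M 1 1),
    le_max_right (M 0 0 + M 0 1) (M 1 0 + M 1 1)]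

theorem le_nrm {M : Mat} (hM : ∀ i j, 0 ≤ M i j) (i j : Fin 2) : M i j ≤ nrm M := by
  have := hM 0 0; have := hM 0 1; have := hM 1 0; have := hM 1 1
  rw [nrm_eq, abs_of_nonneg (hM 0 0), abs_of_nonneg (hM 0 1), abs_of_nonneg (hM 1 0),
    abs_of_nonneg (hM 1 1)]
  fin_cases i <;> fin_cases j <;> simp <;>
    first | (left; linarith) | (right; linarith)

theorem diag_pow_le {M : Mat} (hM : ∀ i j, 0 ≤ M i j) (i : Fin 2) (k : ℕ) :
    (∀ a b, 0 ≤ (M ^ k) a b) ∧ M i i ^ k ≤ (M ^ k) i i := by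
  induction k with
  | zero =>
    refine ⟨fun a b => ?_, by simp⟩
    rw [pow_zero, Matrix.one_apply]
    split_ifs <;> norm_num
  | succ k ih =>
    have hnn : ∀ a b l, 0 ≤ (M ^ k) a l * M l b := fun a b l => mul_nonneg (ih.1 _ _) (hM _ _)
    refine ⟨fun a b => ?_, ?_⟩
    · rw [pow_succ, Matrix.mul_apply]
      exact Finset.sum_nonneg fun l _ => hnn _ _ _
    · rw [pow_succ, pow_succ, Matrix.mul_apply]
      exact (mul_le_mul_of_nonneg_right ih.2 (hM i i)).trans
        (Finset.single_le_sum (fun l _ => hnn i i l) (Finset.mem_univ i))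

theorem diag_pow_le_nrm {M : Mat} (hM : ∀ i j, 0 ≤ M i j) (i : Fin 2) (k : ℕ) :
    M i i ^ k ≤ nrm (M ^ k) :=
  (diag_pow_le hM i k).2.trans (le_nrm (diag_pow_le hM i k).1 i i)

theorem rho_pow_le_nrm {M : Mat} (hM : ∀ i j, 0 < M i j) (k : ℕ) : rho M ^ k ≤ nrm (M ^ k) := by
  obtain ⟨w, hw, hMw⟩ := exists_right_eigenvector hM
  have e : (M ^ k).mulVec w = rho M ^ k • w := by
    induction k with
    | zero => simp
    | succ k ih => rw [pow_succ, ← Matrix.mulVec_mulVec, hMw, Matrix.mulVec_smul, ih, smul_smul,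
        pow_succ']
  have h := nrm_mulVec_le (M ^ k) w
  have hr : 0 < rho M := rho_pos (fun i j => (hM i j).le) (by
    rw [Matrix.trace_fin_two]; exact add_pos (hM _ _) (hM _ _))
  rw [e, norm_smul, Real.norm_eq_abs, abs_of_pos (pow_pos hr k)] at h
  have hw0 : 0 < ‖w‖ := norm_pos_iff.2 fun h0 => (hw 0).ne' (by rw [h0]; rfl)
  exact le_of_mul_le_mul_right h hw0

@[simp] theorem wordProd_nil (B : Fin 2 → Mat) : wordProd B [] = 1 := by simp [wordProd]

@[simp] theorem wordProd_singleton (B : Fin 2 → Mat) (a : Fin 2) : wordProd B [a] = B a := by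
  simp [wordProd]

theorem wordProd_append (B : Fin 2 → Mat) (u v : Word) :
    wordProd B (u ++ v) = wordProd B v * wordProd B u := by simp [wordProd]

theorem wordProd_cons (B : Fin 2 → Mat) (a : Fin 2) (v : Word) :
    wordProd B (a :: v) = wordProd B v * B a := by simp [wordProd]

theorem wordProd_wordPow (B : Fin 2 → Mat) (u : Word) (k : ℕ) :
    wordProd B (wordPow u k) = wordProd B u ^ k := by
  induction k with
  | zero => simp [wordPow]
  | succ k ih => rw [wordPow_succ, wordProd_append, ih, pow_succ]

theorem length_wordPow (u : Word) (k : ℕ) : (wordPow u k).length = k * u.length := by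
  simp [wordPow]

theorem wordProd_scaledPair (A : Fin 2 → Mat) (α : ℝ≥0) (u : Word) :
    wordProd (scaledPair A α) u = (α : ℝ) ^ u.count 1 • wordProd A u := by
  induction u with
  | nil => simp
  | cons a u ih =>
    rw [wordProd_cons, wordProd_cons, ih, List.count_cons]
    fin_cases a
    · simp [scaledPair]
    · simp [scaledPair, pow_succ', smul_smul]

theorem wordProd_nonneg {B : Fin 2 → Mat} (hB : ∀ k i j, 0 ≤ B k i j) (u : Word) :
    ∀ i j, 0 ≤ wordProd B u i j := by
  induction u with
  | nil =>
    intro i j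
    rw [wordProd_nil, Matrix.one_apply]
    split_ifs <;> norm_num
  | cons a u ih =>
    intro i j
    rw [wordProd_cons, Matrix.mul_apply]
    exact Finset.sum_nonneg fun l _ => mul_nonneg (ih _ _) (hB _ _ _)

theorem wordProd_ne_zero {A : Fin 2 → Mat} (hA : ∀ k, IsUnit (A k)) (u : Word) :
    wordProd A u ≠ 0 := by
  have : IsUnit (wordProd A u) := by
    induction u with
    | nil => simp
    | cons a u ih => rw [wordProd_cons]; exact ih.mul (hA a)
  exact this.ne_zero

theorem exists_diag_pos {M : Mat} (h : 0 < M.trace) : ∃ i, 0 < M i i := by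
  rw [Matrix.trace_fin_two] at h
  by_contra! hc
  linarith [hc 0, hc 1]

/-! ### The joint spectral radius -/

/-- The maximal norm of the products of length `n`. -/
def maxNrm (B : Fin 2 → Mat) (n : ℕ) : ℝ := ⨆ w : Fin n → Fin 2, nrm (wordProd B (List.ofFn w))

theorem nrm_le_maxNrm (B : Fin 2 → Mat) (u : Word) : nrm (wordProd B u) ≤ maxNrm B u.length := by
  have h := le_ciSup (f := fun w : Fin u.length → Fin 2 => nrm (wordProd B (List.ofFn w)))
    (Set.finite_range _).bddAbove (fun i => u[i])
  simpa [maxNrm] using h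

theorem exists_nrm_eq_maxNrm (B : Fin 2 → Mat) (n : ℕ) :
    ∃ w : Fin n → Fin 2, nrm (wordProd B (List.ofFn w)) = maxNrm B n :=
  exists_eq_ciSup_of_finite

theorem maxNrm_add_le (B : Fin 2 → Mat) (m n : ℕ) :
    maxNrm B (m + n) ≤ maxNrm B m * maxNrm B n := by
  refine ciSup_le fun w => ?_
  rw [List.ofFn_add, wordProd_append, mul_comm (maxNrm B m)]
  have h1 := nrm_le_maxNrm B (List.ofFn fun i : Fin n => w (Fin.natAdd m i))
  have h2 := nrm_le_maxNrm B (List.ofFn fun i : Fin m => w (Fin.castLE (Nat.le_add_right m n) i))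
  rw [List.length_ofFn] at h1 h2
  exact (nrm_mul_le _ _).trans (mul_le_mul h1 h2 (nrm_nonneg _) ((nrm_nonneg _).trans h1))

theorem iSup_rpow_eq (B : Fin 2 → Mat) (n : ℕ) :
    ⨆ w : Fin n → Fin 2, nrm (wordProd B (List.ofFn w)) ^ (1 / (n : ℝ)) =
      maxNrm B n ^ (1 / (n : ℝ)) := by
  obtain ⟨w, hw⟩ := exists_nrm_eq_maxNrm B n
  refine le_antisymm (ciSup_le fun v => ?_) ?_
  · refine Real.rpow_le_rpow (nrm_nonneg _) ?_ (by positivity)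
    exact le_ciSup (f := fun w : Fin n → Fin 2 => nrm (wordProd B (List.ofFn w)))
      (Set.finite_range _).bddAbove v
  · rw [← hw]
    exact le_ciSup (f := fun w : Fin n → Fin 2 =>
      nrm (wordProd B (List.ofFn w)) ^ (1 / (n : ℝ))) (Set.finite_range _).bddAbove w

theorem rpow_one_div_eq_exp {x : ℝ} (hx : 0 < x) (n : ℕ) :
    x ^ (1 / (n : ℝ)) = Real.exp (Real.log x / n) := by
  rw [Real.rpow_def_of_pos hx, mul_one_div]

/-- Fekete's lemma for the joint spectral radius of a pair with exponentially bounded below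
powers. -/
theorem tendsto_log_maxNrm {B : Fin 2 → Mat} {d : ℝ} (hd : 0 < d)
    (h : ∀ n, d ^ n ≤ nrm (B 0 ^ n)) :
    0 < jointSpectralRadius B ∧ (∀ n, 0 < maxNrm B n) ∧
      Tendsto (fun n : ℕ => Real.log (maxNrm B n) / n) atTop
        (𝓝 (Real.log (jointSpectralRadius B))) := by
  have hlow : ∀ n, d ^ n ≤ maxNrm B n := fun n => by
    have := nrm_le_maxNrm B (wordPow [0] n)
    rw [wordProd_wordPow, wordProd_singleton, length_wordPow] at this
    simpa using (h n).trans (by simpa using this)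
  have hpos : ∀ n, 0 < maxNrm B n := fun n => (pow_pos hd n).trans_le (hlow n)
  have hsub : Subadditive fun n => Real.log (maxNrm B n) := fun m n => by
    rw [← Real.log_mul (hpos m).ne' (hpos n).ne']
    exact Real.log_le_log (hpos _) (maxNrm_add_le B m n)
  have hbdd : BddBelow (Set.range fun n : ℕ => Real.log (maxNrm B n) / n) := by
    refine ⟨min 0 (Real.log d), ?_⟩
    rintro _ ⟨n, rfl⟩
    rcases Nat.eq_zero_or_pos n with rfl | hn
    · simp
    · refine (min_le_right _ _).trans ?_
      have hn' : (0 : ℝ) < n := by exact_mod_cast hn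
      dsimp only
      rw [le_div_iff₀ hn', mul_comm, ← Real.log_pow]
      exact Real.log_le_log (pow_pos hd n) (hlow n)
  have hlim := hsub.tendsto_lim hbdd
  have hJ : jointSpectralRadius B = Real.exp hsub.lim := by
    rw [jointSpectralRadius_eq]
    refine Tendsto.limUnder_eq ?_
    refine ((Real.continuous_exp.tendsto _).comp hlim).congr fun n => ?_
    rw [iSup_rpow_eq, rpow_one_div_eq_exp (hpos n), Function.comp_apply]
  refine ⟨by rw [hJ]; exact Real.exp_pos _, hpos, ?_⟩
  rw [hJ, Real.log_exp]
  exact hlim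

/-! ### Logarithmic parameter and growth of words -/

/-- A bundled exponential, valued in the non-negative reals. -/
def expNN (t : ℝ) : ℝ≥0 := ⟨Real.exp t, (Real.exp_pos t).le⟩

@[simp] theorem coe_expNN (t : ℝ) : (expNN t : ℝ) = Real.exp t := rfl

/-- The logarithm of the joint spectral radius of `(A_0, e^t A_1)`. -/
def logJSR (A : Fin 2 → Mat) (t : ℝ) : ℝ := Real.log (jointSpectralRadius (scaledPair A (expNN t)))

/-- The logarithm of the norm of the product along a word for the pair `(A_0, e^t A_1)`. -/
def logNrm (A : Fin 2 → Mat) (t : ℝ) (u : Word) : ℝ :=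
  Real.log (nrm (wordProd A u)) + t * u.count 1

section Technical

variable {A : Fin 2 → Mat} (hA : TechnicalHypotheses A)

include hA

theorem nrm_wordProd_pos (u : Word) : 0 < nrm (wordProd A u) :=
  nrm_pos (wordProd_ne_zero hA.invertible u)

theorem nrm_scaled_pos (t : ℝ) (u : Word) : 0 < nrm (wordProd (scaledPair A (expNN t)) u) := by
  rw [wordProd_scaledPair, nrm_smul]
  have := nrm_wordProd_pos hA u
  have := Real.exp_pos t
  rw [coe_expNN]
  positivity

theorem log_nrm_scaled (t : ℝ) (u : Word) :
    Real.log (nrm (wordProd (scaledPair A (expNN t)) u)) = logNrm A t u := by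
  rw [wordProd_scaledPair, nrm_smul, coe_expNN, abs_of_pos (pow_pos (Real.exp_pos t) _),
    Real.log_mul (pow_pos (Real.exp_pos t) _).ne' (nrm_wordProd_pos hA u).ne', Real.log_pow,
    Real.log_exp, logNrm]
  ring

theorem tendsto_maxNrm_scaledPair (α : ℝ≥0) :
    0 < jointSpectralRadius (scaledPair A α) ∧ (∀ n, 0 < maxNrm (scaledPair A α) n) ∧
      Tendsto (fun n : ℕ => Real.log (maxNrm (scaledPair A α) n) / n) atTop
        (𝓝 (Real.log (jointSpectralRadius (scaledPair A α)))) := by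
  obtain ⟨i, hi⟩ := exists_diag_pos (hA.trace_pos 0)
  exact tendsto_log_maxNrm hi fun n => diag_pow_le_nrm (hA.nonneg 0) i n

theorem tendsto_logJSR (t : ℝ) :
    Tendsto (fun n : ℕ => Real.log (maxNrm (scaledPair A (expNN t)) n) / n) atTop
      (𝓝 (logJSR A t)) :=
  (tendsto_maxNrm_scaledPair hA (expNN t)).2.2

theorem logNrm_le_log_maxNrm (t : ℝ) (u : Word) :
    logNrm A t u ≤ Real.log (maxNrm (scaledPair A (expNN t)) u.length) := by
  rw [← log_nrm_scaled hA]
  exact Real.log_le_log (nrm_scaled_pos hA t u) (nrm_le_maxNrm _ u)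

theorem weaklyExtremal_iff_tendsto (t : ℝ) (x : InfWord) :
    WeaklyExtremal (scaledPair A (expNN t)) x ↔
      Tendsto (fun n : ℕ => logNrm A t (pre x n) / n) atTop (𝓝 (logJSR A t)) := by
  have hJ := (tendsto_maxNrm_scaledPair hA (expNN t)).1
  rw [weaklyExtremal_iff]
  have e : ∀ n : ℕ, nrm (wordProd (scaledPair A (expNN t)) (pre x n)) ^ (1 / (n : ℝ)) =
      Real.exp (logNrm A t (pre x n) / n) := fun n => by
    rw [rpow_one_div_eq_exp (nrm_scaled_pos hA t _), log_nrm_scaled hA]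
  simp only [e]
  constructor
  · intro h
    have := (Real.continuousAt_log hJ.ne').tendsto.comp h
    refine this.congr fun n => ?_
    simp
  · intro h
    have := (Real.continuous_exp.tendsto _).comp h
    rwa [logJSR, Real.exp_log hJ] at this

theorem eventually_logNrm_le (t : ℝ) {ε : ℝ} (hε : 0 < ε) :
    ∀ᶠ n : ℕ in atTop, ∀ u : Word, u.length = n → logNrm A t u ≤ (logJSR A t + ε) * n := by
  have h := (tendsto_logJSR hA t).eventually (gt_mem_nhds (lt_add_of_pos_right _ hε))
  filter_upwards [h, eventually_gt_atTop 0] with n hn hn0 u hu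
  have hn' : (0 : ℝ) < n := by exact_mod_cast hn0
  rw [div_lt_iff₀ hn'] at hn
  subst hu
  exact (logNrm_le_log_maxNrm hA t u).trans hn.le

/-- The powers of u compete for the maximal norm along multiples of its length. A general d covers
Perron roots of positive products as well as diagonal entries of single letters. -/
theorem le_logJSR_of_pow_le {u : Word} (hu : u ≠ []) {d : ℝ} (hd : 0 < d)
    (h : ∀ k, d ^ k ≤ nrm (wordProd A u ^ k)) (t : ℝ) :
    Real.log d + t * u.count 1 ≤ u.length * logJSR A t := by
  have hl : 0 < u.length := List.length_pos_iff.2 hu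
  have hlR : (0 : ℝ) < u.length := by exact_mod_cast hl
  have hsub : Tendsto (fun k : ℕ => k * u.length) atTop atTop :=
    tendsto_id.atTop_mul_const' hl
  have hT := (tendsto_logJSR hA t).comp hsub
  rw [← div_le_iff₀' hlR]
  refine ge_of_tendsto hT ?_
  filter_upwards [eventually_gt_atTop 0] with k hk
  have hkR : (0 : ℝ) < k := by exact_mod_cast hk
  have h1 := logNrm_le_log_maxNrm hA t (wordPow u k)
  rw [length_wordPow, logNrm, wordProd_wordPow, count_wordPow] at h1
  have h2 := Real.log_le_log (pow_pos hd k) (h k)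
  rw [Real.log_pow] at h2
  simp only [Function.comp_apply]
  rw [div_le_div_iff₀ hlR (by positivity)]
  push_cast at *
  have h3 : k * (Real.log d + t * u.count 1) ≤
      Real.log (maxNrm (scaledPair A (expNN t)) (k * u.length)) := by linarith
  nlinarith [mul_le_mul_of_nonneg_right h3 hlR.le]

/-- A word of length n has at most n ones, so changing t moves its normalised log norm by at most
|t' - t|. -/
theorem logJSR_le_add_abs (t t' : ℝ) : logJSR A t' ≤ logJSR A t + |t' - t| := by
  refine le_of_tendsto_of_tendsto (tendsto_logJSR hA t')
    ((tendsto_logJSR hA t).add_const |t' - t|) ?_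
  filter_upwards [eventually_gt_atTop 0] with n hn
  have hn' : (0 : ℝ) < n := by exact_mod_cast hn
  obtain ⟨w, hw⟩ := exists_nrm_eq_maxNrm (scaledPair A (expNN t')) n
  have h1 := logNrm_le_log_maxNrm hA t (List.ofFn w)
  rw [← hw, log_nrm_scaled hA, div_add' _ _ _ hn'.ne', div_le_div_iff_of_pos_right hn']
  rw [List.length_ofFn] at h1
  have hc : ((List.ofFn w).count 1 : ℝ) ≤ n := by
    have := List.count_le_length (a := (1 : Fin 2)) (l := List.ofFn w)
    rw [List.length_ofFn] at this
    exact_mod_cast this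
  have h2 : (t' - t) * (List.ofFn w).count 1 ≤ |t' - t| * n :=
    mul_le_mul (le_abs_self _) hc (by positivity) (abs_nonneg _)
  simp only [logNrm] at *
  linarith

end Technical

/-! ### Gluing infinite words -/

theorem take_pre (x : InfWord) {m n : ℕ} (h : m ≤ n) : (pre x n).take m = pre x m := by
  obtain ⟨k, rfl⟩ := Nat.exists_eq_add_of_le h
  rw [pre_add, List.take_append_of_le_length (by simp), List.take_of_length_le (by simp)]

theorem exists_pre_eq_take {p : ℕ → Word} (hp : ∀ k, p k <+: p (k + 1))
    (hlen : ∀ k, k ≤ (p k).length) : ∃ y : InfWord, ∀ k n, n ≤ (p k).length →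
      pre y n = (p k).take n := by
  have hmono : ∀ {k m}, k ≤ m → p k <+: p m := fun {k m} h => by
    induction m, h using Nat.le_induction with
    | base => exact List.prefix_refl _
    | succ m _ ih => exact ih.trans (hp m)
  refine ⟨fun i => (p (i + 1)).getD i 0, fun k n hn => ?_⟩
  refine List.ext_getElem (by simp [hn]) fun i h1 h2 => ?_
  have hik : i < (p k).length := by
    rw [length_pre] at h1; omega
  have hi1 : i < (p (i + 1)).length := hlen (i + 1)
  simp only [pre, List.getElem_ofFn, List.getElem_take, List.getD_eq_getElem _ _ hi1]
  rcases le_total k (i + 1) with h | h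
  · exact ((hmono h).getElem hik).symm
  · exact (hmono h).getElem hi1

/-- Concatenate ever longer prefixes of the y_k. Block k is long enough, relative to what is already
built, to absorb the accumulated deficit, its own constant and the constant of the next block. -/
theorem exists_glued {F : Word → ℝ}
    (h : ∀ k : ℕ, ∃ (y : InfWord) (C : ℝ), ∀ u n, F u - n / (k + 1) - C ≤ F (u ++ pre y n)) :
    ∃ y : InfWord, ∀ ε > 0, ∀ᶠ n : ℕ in atTop, -ε * n ≤ F (pre y n) := by
  choose y C hC using h
  have hl : ∀ (k : ℕ) (u : Word), ∃ l : ℕ, 1 ≤ l ∧ (k + 1) * (C k + C (k + 1) - F u) ≤ l := by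
    intro k u
    obtain ⟨l, hl⟩ := exists_nat_ge (max 1 ((k + 1) * (C k + C (k + 1) - F u)))
    exact ⟨l, by exact_mod_cast (le_max_left _ _).trans hl, (le_max_right _ _).trans hl⟩
  choose l hl1 hl2 using hl
  let p : ℕ → Word := fun k => Nat.rec [] (fun k u => u ++ pre (y k) (l k u)) k
  have hps : ∀ k, p (k + 1) = p k ++ pre (y k) (l k (p k)) := fun k => rfl
  have hlens : ∀ k, (p (k + 1)).length = (p k).length + l k (p k) := fun k => by
    rw [hps, List.length_append, length_pre]
  have hlt : ∀ k, (p k).length < (p (k + 1)).length := fun k => by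
    have := hl1 k (p k)
    rw [hlens]
    omega
  have hlen : ∀ k, k ≤ (p k).length := fun k => by
    induction k with
    | zero => exact Nat.zero_le _
    | succ k ih => exact ih.trans_lt (hlt k)
  obtain ⟨z, hz⟩ := exists_pre_eq_take (p := p) (fun k => ⟨_, rfl⟩) hlen
  have hblock : ∀ K N, (p K).length ≤ N → ∃ k, K ≤ k ∧ (p k).length ≤ N ∧
      N < (p (k + 1)).length := by
    intro K N hN
    induction N, hN using Nat.le_induction with
    | base => exact ⟨K, le_rfl, le_rfl, hlt K⟩
    | succ N _ ih =>
      obtain ⟨k, hk, h1, h2⟩ := ih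
      by_cases h3 : N + 1 < (p (k + 1)).length
      · exact ⟨k, hk, by omega, h3⟩
      · have := hlt (k + 1)
        exact ⟨k + 1, by omega, by omega, by omega⟩
  -- One share 1/(k + 1) pays the linear loss of block k, the other pays the constants through the
  -- choice of `l`.
  have hF : ∀ k, -(2 / (k + 1)) * (p (k + 1)).length ≤ F (p (k + 1)) - C (k + 1) := by
    intro k
    have h1 := hC k (p k) (l k (p k))
    have h2 := hl2 k (p k)
    rw [← hps] at h1
    rw [hlens]
    have hk : (0 : ℝ) < k + 1 := by positivity
    rw [← le_div_iff₀' hk] at h2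
    have h3 : (0 : ℝ) ≤ 2 / (k + 1) * (p k).length := by positivity
    have h4 : (2 : ℝ) / (k + 1) * l k (p k) = l k (p k) / (k + 1) + l k (p k) / (k + 1) := by ring
    push_cast
    linarith
  refine ⟨z, fun ε hε => ?_⟩
  obtain ⟨K, hK⟩ := exists_nat_ge (2 / ε)
  filter_upwards [eventually_ge_atTop (p (K + 1)).length] with N hN
  obtain ⟨k, hk, h1, h2⟩ := hblock (K + 1) N hN
  obtain ⟨j, rfl⟩ : ∃ j, k = j + 1 := ⟨k - 1, by omega⟩
  obtain ⟨n, rfl⟩ := Nat.exists_eq_add_of_le h1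
  rw [hlens (j + 1)] at h2
  have hpre : pre z ((p (j + 1)).length + n) = p (j + 1) ++ pre (y (j + 1)) n := by
    rw [hz (j + 1 + 1) _ (by rw [hlens (j + 1)]; omega), hps (j + 1), List.take_append,
      List.take_of_length_le (by omega), Nat.add_sub_cancel_left, take_pre _ (by omega)]
  have h3 := hC (j + 1) (p (j + 1)) n
  have h4 := hF j
  rw [hpre]
  have hj : (K : ℝ) ≤ j := by exact_mod_cast (by omega : K ≤ j)
  have hj1 : (0 : ℝ) < j + 1 := by positivity
  have h5 : 2 / ((j : ℝ) + 1) ≤ ε := by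
    rw [div_le_iff₀ hj1]
    rw [div_le_iff₀ hε] at hK
    nlinarith
  have h6 : (n : ℝ) / (((j + 1 : ℕ) : ℝ) + 1) ≤ ε * n := by
    rw [div_eq_inv_mul]
    refine mul_le_mul_of_nonneg_right (le_trans ?_ h5) (by positivity)
    rw [← one_div, div_le_div_iff₀ (by positivity) hj1]
    push_cast
    linarith
  have h7 := mul_le_mul_of_nonneg_right h5 (show (0 : ℝ) ≤ (p (j + 1)).length by positivity)
  push_cast at *
  linarith

/-- The infinite word `01x`. -/
def zeroOneCons (x : InfWord) : InfWord
  | 0 => 0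
  | 1 => 1
  | n + 2 => x n

theorem pre_zeroOneCons (x : InfWord) (n : ℕ) :
    pre (zeroOneCons x) (n + 2) = [0, 1] ++ pre x n := by
  simp [pre, List.ofFn_succ, zeroOneCons]

/-- A functional on words which is superadditive up to insertion of `01` and loses a bounded
amount when a letter is appended. -/
def GlueAdditive (F : Word → ℝ) : Prop :=
  ∃ C, (∀ u v, F u + F v - C ≤ F (u ++ [0, 1] ++ v)) ∧ ∀ u a, F u - C ≤ F (u ++ [a])

theorem GlueAdditive.min {F G : Word → ℝ} (hF : GlueAdditive F) (hG : GlueAdditive G) :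
    GlueAdditive fun u => min (F u) (G u) := by
  obtain ⟨C, h1, h2⟩ := hF
  obtain ⟨D, h3, h4⟩ := hG
  refine ⟨max C D, fun u v => le_min ?_ ?_, fun u a => le_min ?_ ?_⟩
  · linarith [h1 u v, min_le_left (F u) (G u), min_le_left (F v) (G v), le_max_left C D]
  · linarith [h3 u v, min_le_right (F u) (G u), min_le_right (F v) (G v), le_max_right C D]
  · linarith [h2 u a, min_le_left (F u) (G u), le_max_left C D]
  · linarith [h4 u a, min_le_right (F u) (G u), le_max_right C D]

theorem exists_lower_bound_of_eventually {a : ℕ → ℝ} {η : ℝ} (h : ∀ᶠ n : ℕ in atTop, -η * n ≤ a n) :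
    ∃ C, ∀ n : ℕ, -η * n - C ≤ a n := by
  obtain ⟨N, hN⟩ := eventually_atTop.1 h
  obtain ⟨C, hC⟩ := ((Finset.range N).image fun n : ℕ => -η * n - a n).bddAbove
  refine ⟨max C 0, fun n => ?_⟩
  rcases lt_or_ge n N with h1 | h1
  · have := hC (Finset.mem_coe.2 (Finset.mem_image_of_mem (fun n : ℕ => -η * n - a n)
      (Finset.mem_range.2 h1)))
    linarith [le_max_left C 0]
  · linarith [hN n h1, le_max_right C 0]

/-- Each block is opened with 01, so that appending it to an arbitrary word costs only a constant.
-/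
theorem GlueAdditive.exists_of_forall {F : Word → ℝ} (hF : GlueAdditive F)
    (h : ∀ k : ℕ, ∃ x : InfWord, ∀ᶠ n : ℕ in atTop, -(1 / ((k : ℝ) + 1)) * n ≤ F (pre x n)) :
    ∃ y : InfWord, ∀ ε > 0, ∀ᶠ n : ℕ in atTop, -ε * n ≤ F (pre y n) := by
  obtain ⟨C, h1, h2⟩ := hF
  refine exists_glued fun k => ?_
  obtain ⟨x, hx⟩ := h k
  obtain ⟨D, hD⟩ := exists_lower_bound_of_eventually hx
  have hk : (0 : ℝ) < k + 1 := by positivity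
  refine ⟨zeroOneCons x, max 0 C + max 0 D, fun u n => ?_⟩
  have hC0 := le_max_left 0 C
  have hC1 := le_max_right 0 C
  have hD0 := le_max_left 0 D
  have hD1 := le_max_right 0 D
  match n with
  | 0 => simp; linarith
  | 1 =>
    have := h2 u 0
    have e : pre (zeroOneCons x) 1 = [0] := by simp [pre, zeroOneCons]
    have h0 : (0 : ℝ) ≤ 1 / (k + 1) := by positivity
    rw [e]
    push_cast
    linarith
  | n + 2 =>
    rw [pre_zeroOneCons, ← List.append_assoc]
    have e : -(1 / ((k : ℝ) + 1)) * n = -(n / (k + 1)) := by ring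
    have e' : ((n + 2 : ℕ) : ℝ) / (k + 1) = n / (k + 1) + 2 / (k + 1) := by push_cast; ring
    have h0 : (0 : ℝ) ≤ 2 / (k + 1) := by positivity
    have := hD n
    rw [e] at this
    rw [e']
    linarith [h1 u (pre x n)]

/-- The deviation of the number of ones from the expected one. -/
theorem glueAdditive_count (σ γ : ℝ) :
    GlueAdditive fun u : Word => σ * ((u.count 1 : ℝ) - γ * u.length) := by
  refine ⟨max (max (-(σ * (1 - γ * 2))) (σ * γ)) (-(σ * (1 - γ))), fun u v => ?_, fun u a => ?_⟩
  · have := (le_max_left _ _).trans (le_max_left (max (-(σ * (1 - γ * 2))) (σ * γ)) (-(σ * (1 - γ))))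
    have e : (([0, 1] : Word).count 1 : ℝ) = 1 := by simp
    simp only [List.count_append, List.length_append, Nat.cast_add, e]
    simp only [List.length_cons, List.length_nil, zero_add, Nat.reduceAdd, Nat.cast_ofNat]
    linarith
  · fin_cases a
    · have := (le_max_right _ _).trans
        (le_max_left (max (-(σ * (1 - γ * 2))) (σ * γ)) (-(σ * (1 - γ))))
      simp
      linarith
    · have := le_max_right (max (-(σ * (1 - γ * 2))) (σ * γ)) (-(σ * (1 - γ)))
      simp
      linarith

theorem entrySum_mul_mul_le {V W U : Mat} (hV : ∀ i j, 0 ≤ V i j) (hU : ∀ i j, 0 ≤ U i j) {c : ℝ}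
    (hW : ∀ i j, c ≤ W i j) : c * (entrySum V * entrySum U) ≤ entrySum (V * W * U) := by
  have h : ∀ i j k l, c * (V i j * U k l) ≤ V i j * W j k * U k l := fun i j k l => by
    have := mul_le_mul_of_nonneg_left (hW j k) (mul_nonneg (hV i j) (hU k l))
    linarith
  simp only [entrySum, Matrix.mul_apply, Fin.sum_univ_two]
  linarith [h 0 0 0 0, h 0 0 0 1, h 0 0 1 0, h 0 0 1 1, h 0 1 0 0, h 0 1 0 1, h 0 1 1 0, h 0 1 1 1,
    h 1 0 0 0, h 1 0 0 1, h 1 0 1 0, h 1 0 1 1, h 1 1 0 0, h 1 1 0 1, h 1 1 1 0, h 1 1 1 1]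

theorem exists_pos_le_entries {M : Mat} (hM : ∀ i j, 0 < M i j) : ∃ c > 0, ∀ i j, c ≤ M i j := by
  refine ⟨min (min (M 0 0) (M 0 1)) (min (M 1 0) (M 1 1)), ?_, fun i j => ?_⟩
  · exact lt_min (lt_min (hM _ _) (hM _ _)) (lt_min (hM _ _) (hM _ _))
  · fin_cases i <;> fin_cases j <;> simp

theorem tendsto_count_div {A : Fin 2 → Mat} {r : ℝ≥0 → Set.Icc (0 : ℝ) 1}
    (hr : IsOneRatioFunction A r) {α : ℝ≥0} {x : InfWord}
    (hx : WeaklyExtremal (scaledPair A α) x) :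
    Tendsto (fun n : ℕ => ((pre x n).count 1 : ℝ) / n) atTop (𝓝 (r α : ℝ)) := by
  simpa only [count_pre] using hr.ratio α x hx

section Technical

variable {A : Fin 2 → Mat} (hA : TechnicalHypotheses A)

include hA

theorem wordProd_pos_of_mem {u : Word} (h0 : 0 ∈ u) (h1 : 1 ∈ u) : ∀ i j, 0 < wordProd A u i j := by
  refine hA.mixed_word_pos u fun n => ⟨?_, ?_⟩
  · rintro rfl
    simpa using List.eq_of_mem_replicate h1
  · rintro rfl
    simpa using List.eq_of_mem_replicate h0

/-- The product along 01 has entries at least c > 0, so inserting it makes the norm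
supermultiplicative up to the factor c/2. Appending a letter costs a constant because the letter
matrices are invertible. -/
theorem glueAdditive_logNrm (t f : ℝ) :
    GlueAdditive fun u : Word => logNrm A t u - f * u.length := by
  obtain ⟨c, hc, hW⟩ := exists_pos_le_entries
    (wordProd_pos_of_mem hA (u := [0, 1]) (by simp) (by simp))
  have hletter : ∀ a : Fin 2, ∃ C, ∀ u : Word, Real.log (nrm (wordProd A u)) - C ≤
      Real.log (nrm (wordProd A (u ++ [a]))) := fun a => by
    refine ⟨Real.log (nrm (A a)⁻¹), fun u => ?_⟩
    rw [sub_le_iff_le_add', ← Real.log_mul (nrm_pos (Matrix.isUnit_nonsing_inv_iff.2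
      (hA.invertible a)).ne_zero).ne' (nrm_wordProd_pos hA _).ne']
    refine Real.log_le_log (nrm_wordProd_pos hA u) ?_
    refine le_of_eq_of_le ?_ (nrm_mul_le _ _)
    rw [wordProd_append, wordProd_singleton, ← mul_assoc, Matrix.nonsing_inv_mul, one_mul]
    exact (Matrix.isUnit_iff_isUnit_det _).1 (hA.invertible a)
  obtain ⟨C0, hC0⟩ := hletter 0
  obtain ⟨C1, hC1⟩ := hletter 1
  refine ⟨max (-(Real.log (c / 2) + t - f * 2)) (max (C0 + f) (C1 - t + f)), fun u v => ?_,
    fun u a => ?_⟩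
  · have h1 := entrySum_mul_mul_le (wordProd_nonneg hA.nonneg v) (wordProd_nonneg hA.nonneg u) hW
    have hU := nrm_wordProd_pos hA u
    have hV := nrm_wordProd_pos hA v
    have h2 := nrm_le_entrySum (wordProd_nonneg hA.nonneg u)
    have h3 := nrm_le_entrySum (wordProd_nonneg hA.nonneg v)
    have e0 : wordProd A (u ++ [0, 1] ++ v) = wordProd A v * wordProd A [0, 1] * wordProd A u := by
      rw [wordProd_append, wordProd_append, mul_assoc]
    have h4 := entrySum_le (wordProd_nonneg hA.nonneg (u ++ [0, 1] ++ v))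
    rw [e0] at h4
    have h5 : c / 2 * (nrm (wordProd A v) * nrm (wordProd A u)) ≤
        nrm (wordProd A (u ++ [0, 1] ++ v)) := by
      have := mul_le_mul_of_nonneg_left (mul_le_mul h3 h2 hU.le (hV.le.trans h3)) hc.le
      rw [e0]
      linarith
    have h6 := Real.log_le_log (by positivity) h5
    rw [Real.log_mul (by positivity) (by positivity), Real.log_mul hV.ne' hU.ne'] at h6
    have e : (([0, 1] : Word).count 1 : ℝ) = 1 := by simp
    have hm := le_max_left (-(Real.log (c / 2) + t - f * 2)) (max (C0 + f) (C1 - t + f))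
    simp only [logNrm, List.count_append, List.length_append, Nat.cast_add, e]
    simp only [List.length_cons, List.length_nil, zero_add, Nat.reduceAdd, Nat.cast_ofNat]
    linarith
  · have hm := le_max_right (-(Real.log (c / 2) + t - f * 2)) (max (C0 + f) (C1 - t + f))
    have hm0 := (le_max_left _ _).trans hm
    have hm1 := (le_max_right _ _).trans hm
    have hc0 := hC0 u
    have hc1 := hC1 u
    fin_cases a
    · have e : (([0] : Word).count 1 : ℝ) = 0 := by simp
      simp only [Fin.zero_eta, logNrm, List.count_append, List.length_append, Nat.cast_add, e]
      simp only [List.length_cons, List.length_nil, zero_add, Nat.cast_one]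
      linarith
    · have e : (([1] : Word).count 1 : ℝ) = 1 := by simp
      simp only [Fin.mk_one, logNrm, List.count_append, List.length_append, Nat.cast_add, e]
      simp only [List.length_cons, List.length_nil, zero_add, Nat.cast_one]
      linarith

theorem exists_le_logJSR : ∃ c, ∀ t, c ≤ logJSR A t ∧ c + t ≤ logJSR A t := by
  obtain ⟨i, hi⟩ := exists_diag_pos (hA.trace_pos 0)
  obtain ⟨j, hj⟩ := exists_diag_pos (hA.trace_pos 1)
  refine ⟨min (Real.log (A 0 i i)) (Real.log (A 1 j j)), fun t => ⟨?_, ?_⟩⟩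
  · have := le_logJSR_of_pow_le hA (u := [0]) (by simp) hi (fun k => by
      rw [wordProd_singleton]; exact diag_pow_le_nrm (hA.nonneg 0) i k) t
    simp at this
    exact (min_le_left _ _).trans this
  · have := le_logJSR_of_pow_le hA (u := [1]) (by simp) hj (fun k => by
      rw [wordProd_singleton]; exact diag_pow_le_nrm (hA.nonneg 1) j k) t
    simp at this
    linarith [min_le_right (Real.log (A 0 i i)) (Real.log (A 1 j j))]

/-! ### The one-ratio function -/

variable {r : ℝ≥0 → Set.Icc (0 : ℝ) 1} (hr : IsOneRatioFunction A r)

include hr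

theorem exists_tendsto_logNrm (t : ℝ) : ∃ x : InfWord,
    Tendsto (fun n : ℕ => ((pre x n).count 1 : ℝ) / n) atTop (𝓝 (r (expNN t) : ℝ)) ∧
    ∀ t', Tendsto (fun n : ℕ => logNrm A t' (pre x n) / n) atTop
      (𝓝 (logJSR A t + (t' - t) * r (expNN t))) := by
  have hx := hr.weaklyExtremal (expNN t) _ (mech_mem_sturmianSet (r (expNN t)).2.1
    (r (expNN t)).2.2)
  have hc := tendsto_count_div hr hx
  refine ⟨_, hc, fun t' => ?_⟩
  rw [weaklyExtremal_iff_tendsto hA] at hx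
  refine (hx.add (hc.const_mul (t' - t))).congr fun n => ?_
  simp only [logNrm]
  ring

/-- The Sturmian word extremal at t is a competitor at t', so the ratio is a subgradient of
`logJSR`. -/
theorem logJSR_add_le (t t' : ℝ) : logJSR A t + (t' - t) * r (expNN t) ≤ logJSR A t' := by
  obtain ⟨x, -, hx⟩ := exists_tendsto_logNrm hA hr t
  refine le_of_tendsto_of_tendsto' (hx t') (tendsto_logJSR hA t') fun n => ?_
  have := logNrm_le_log_maxNrm hA t' (pre x n)
  rw [length_pre] at this
  exact div_le_div_of_nonneg_right this n.cast_nonneg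

/-- Words extremal at parameters near τ are nearly extremal at τ with ratio on the prescribed side
of γ. Gluing for the minimum of norm and counting functionals preserves both properties in the
limit, and extremality at τ then determines the ratio. -/
theorem isClosed_ratio (σ γ : ℝ) : IsClosed {t : ℝ | 0 ≤ σ * ((r (expNN t) : ℝ) - γ)} := by
  refine isClosed_of_closure_subset fun τ hτ => ?_
  rw [Metric.mem_closure_iff] at hτ
  have hglue := (glueAdditive_logNrm hA τ (logJSR A τ)).min (glueAdditive_count σ γ)
  obtain ⟨y, hy⟩ := hglue.exists_of_forall fun k => by
    have hk : (0 : ℝ) < 1 / (k + 1) := by positivity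
    -- The distance |τ - t| is lost twice, through the Lipschitz bound and through the slope term; a
    -- quarter leaves room for strictness.
    obtain ⟨t, ht, hd⟩ := hτ (1 / (k + 1) / 4) (by positivity)
    obtain ⟨x, hx1, hx2⟩ := exists_tendsto_logNrm hA hr t
    have hlip := logJSR_le_add_abs hA t τ
    rw [Real.dist_eq] at hd
    have hr0 := (r (expNN t)).2.1
    have hr1 := (r (expNN t)).2.2
    have habs : -|τ - t| ≤ (τ - t) * r (expNN t) := by
      have : |(τ - t) * r (expNN t)| ≤ |τ - t| := by
        rw [abs_mul, abs_of_nonneg hr0]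
        exact mul_le_of_le_one_right (abs_nonneg _) hr1
      linarith [neg_abs_le ((τ - t) * (r (expNN t) : ℝ))]
    have e1 := (hx2 τ).eventually (lt_mem_nhds
      (show logJSR A τ - 1 / (k + 1) < _ by linarith))
    have e2 := ((hx1.sub_const γ).const_mul σ).eventually (lt_mem_nhds
      (show -(1 / ((k : ℝ) + 1)) < _ from lt_of_lt_of_le (by linarith) ht))
    refine ⟨x, ?_⟩
    filter_upwards [e1, e2, eventually_gt_atTop 0] with n h1 h2 hn
    have hn' : (0 : ℝ) < n := by exact_mod_cast hn
    refine le_min ?_ ?_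
    · rw [lt_div_iff₀ hn'] at h1
      rw [length_pre]
      linarith
    · have := mul_lt_mul_of_pos_right h2 hn'
      have e : σ * (((pre x n).count 1 : ℝ) / n - γ) * n =
        σ * (((pre x n).count 1 : ℝ) - γ * n) := by field_simp
      rw [length_pre, ← e]
      exact this.le
  have hwe : WeaklyExtremal (scaledPair A (expNN τ)) y := by
    rw [weaklyExtremal_iff_tendsto hA, Metric.tendsto_nhds]
    intro ε hε
    filter_upwards [hy (ε / 2) (by positivity), eventually_logNrm_le hA τ (half_pos hε),
      eventually_gt_atTop 0] with n h1 h2 hn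
    have hn' : (0 : ℝ) < n := by exact_mod_cast hn
    have h3 := h2 (pre y n) (length_pre _ _)
    have h4 := h1.trans (min_le_left _ _)
    rw [length_pre] at h4
    have : logNrm A τ (pre y n) / n * n = logNrm A τ (pre y n) := by field_simp
    rw [Real.dist_eq, abs_sub_lt_iff]
    constructor
    · refine lt_of_mul_lt_mul_right (a := (n : ℝ)) ?_ hn'.le
      rw [sub_mul, this]
      nlinarith
    · refine lt_of_mul_lt_mul_right (a := (n : ℝ)) ?_ hn'.le
      rw [sub_mul, this]
      nlinarith
  have hc := ((tendsto_count_div hr hwe).sub_const γ).const_mul σ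
  change 0 ≤ σ * ((r (expNN τ) : ℝ) - γ)
  refine le_of_forall_pos_le_add fun ε hε => ?_
  have : -ε ≤ σ * ((r (expNN τ) : ℝ) - γ) := by
    refine ge_of_tendsto hc ?_
    filter_upwards [hy ε hε, eventually_gt_atTop 0] with n h1 hn
    have hn' : (0 : ℝ) < n := by exact_mod_cast hn
    have h4 := h1.trans (min_le_right _ _)
    have e : σ * (((pre y n).count 1 : ℝ) / n - γ) * n =
      σ * (((pre y n).count 1 : ℝ) - γ * n) := by field_simp
    rw [length_pre, ← e] at h4
    exact le_of_mul_le_mul_right h4 hn'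
  linarith

/-- Every value strictly between `0` and `1` is attained by the one-ratio function. -/
theorem exists_ratio_eq {γ : ℝ} (h0 : 0 < γ) (h1 : γ < 1) : ∃ t, (r (expNN t) : ℝ) = γ := by
  have hc1 := isClosed_ratio hA hr 1 γ
  have hc2 := isClosed_ratio hA hr (-1) γ
  obtain ⟨c, hc⟩ := exists_le_logJSR hA
  have hn1 : ∃ t, 0 ≤ 1 * ((r (expNN t) : ℝ) - γ) := by
    by_contra! hcon
    -- A ratio below γ at this t would give c + t(1 - γ) ≤ `logJSR` at 0 by the subgradient
    -- inequality.
    set t := max 1 ((logJSR A 0 - c + 1) / (1 - γ)) with ht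
    have ht1 : 1 ≤ t := le_max_left _ _
    have ht2 : (logJSR A 0 - c + 1) / (1 - γ) ≤ t := le_max_right _ _
    rw [div_le_iff₀ (by linarith)] at ht2
    have := logJSR_add_le hA hr t 0
    nlinarith [hcon t, (hc t).2]
  have hn2 : ∃ t, 0 ≤ -1 * ((r (expNN t) : ℝ) - γ) := by
    by_contra! hcon
    set t := max 1 ((logJSR A 0 - c + 1) / γ) with ht
    have ht1 : 1 ≤ t := le_max_left _ _
    have ht2 : (logJSR A 0 - c + 1) / γ ≤ t := le_max_right _ _
    rw [div_le_iff₀ h0] at ht2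
    have := logJSR_add_le hA hr (-t) 0
    nlinarith [hcon (-t), (hc (-t)).1]
  obtain ⟨t, -, h2, h3⟩ := isPreconnected_closed_iff.1 isPreconnected_univ _ _ hc1 hc2
    (fun t _ => by
      rcases le_total γ (r (expNN t)) with h | h
      · exact Or.inl (show 0 ≤ 1 * ((r (expNN t) : ℝ) - γ) by linarith)
      · exact Or.inr (show 0 ≤ -1 * ((r (expNN t) : ℝ) - γ) by linarith))
    (by simpa [Set.Nonempty] using hn1) (by simpa [Set.Nonempty] using hn2)
  have h2' : 0 ≤ 1 * ((r (expNN t) : ℝ) - γ) := h2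
  have h3' : 0 ≤ -1 * ((r (expNN t) : ℝ) - γ) := h3
  exact ⟨t, by linarith⟩

/-- At the parameter `0` the one-ratio function vanishes. -/
theorem ratio_zero : (r 0 : ℝ) = 0 := by
  have hx := hr.weaklyExtremal 0 _ (mech_mem_sturmianSet (r 0).2.1 (r 0).2.2)
  have hc := tendsto_count_div hr hx
  rw [weaklyExtremal_iff] at hx
  have hJ := (tendsto_maxNrm_scaledPair hA 0).1
  refine tendsto_nhds_unique hc (tendsto_const_nhds.congr' ?_)
  have hev := hx.eventually (lt_mem_nhds hJ)
  filter_upwards [hev, eventually_gt_atTop 0] with n hn hn0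
  rw [wordProd_scaledPair] at hn
  -- A single letter 1 would annihilate the product, while its normalised norm is eventually
  -- positive.
  have : (pre (mech (r 0 : ℝ)) n).count 1 = 0 := by
    by_contra hne
    simp only [NNReal.coe_zero, zero_pow hne, zero_smul, nrm_zero] at hn
    rw [Real.zero_rpow (by positivity)] at hn
    exact lt_irrefl _ hn
  simp [this]

end Technical

/-! ### Spectral radii along the standard words -/

theorem mem_wordPow {u : Word} {a : Fin 2} (h : a ∈ u) {k : ℕ} (hk : 1 ≤ k) : a ∈ wordPow u k := by
  obtain ⟨k, rfl⟩ : ∃ j, k = j + 1 := ⟨k - 1, by omega⟩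
  rw [wordPow_succ]
  exact List.mem_append_left _ h

theorem mem_stdWord {a : ℕ → ℕ} (ha : ∀ n, 1 ≤ a (n + 1)) (n : ℕ) :
    0 ∈ stdWord a (n + 3) ∧ 1 ∈ stdWord a (n + 3) := by
  induction n with
  | zero =>
    have h1 : (1 : Fin 2) ∈ stdWord a 2 := by simp [stdWord]
    exact ⟨List.mem_append_right _ (by simp [stdWord]),
      List.mem_append_left _ (mem_wordPow h1 (ha 1))⟩
  | succ n ih =>
    exact ⟨List.mem_append_left _ (mem_wordPow ih.1 (ha _)),
      List.mem_append_left _ (mem_wordPow ih.2 (ha _))⟩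

theorem wordProd_stdWord_succ (A : Fin 2 → Mat) (a : ℕ → ℕ) (n : ℕ) :
    wordProd A (stdWord a (n + 3)) =
      wordProd A (stdWord a (n + 1)) * wordProd A (stdWord a (n + 2)) ^ a (n + 2) := by
  rw [← wordProd_wordPow, ← wordProd_append]
  rfl

theorem lt_contDen_succ {a : ℕ → ℕ} (ha : ∀ n, 1 ≤ a (n + 1)) (n : ℕ) :
    contDen a (n + 1) < contDen a (n + 2) := by
  have h1 := contDen_pos ha n
  have h2 : 1 * contDen a (n + 1) ≤ a (n + 2) * contDen a (n + 1) :=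
    Nat.mul_le_mul_right _ (ha (n + 1))
  simp only [contDen]
  omega

theorem strictMono_contDen {a : ℕ → ℕ} (ha : ∀ n, 1 ≤ a (n + 1)) :
    StrictMono fun n => contDen a (n + 1) :=
  strictMono_nat_of_lt_succ fun n => lt_contDen_succ ha n

theorem two_mul_contDen_le {a : ℕ → ℕ} (ha : ∀ n, 1 ≤ a (n + 1)) (n : ℕ) :
    2 * contDen a n ≤ contDen a (n + 2) := by
  have h2 : 1 * contDen a (n + 1) ≤ a (n + 2) * contDen a (n + 1) :=
    Nat.mul_le_mul_right _ (ha (n + 1))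
  have h3 : contDen a n ≤ contDen a (n + 1) := by
    cases n with
    | zero => exact ha 0
    | succ n => exact (lt_contDen_succ ha n).le
  simp only [contDen]
  omega

/-! ### Crossing parameters and alternating increments -/

/-- The logarithm of the parameter at which the spectral radii along two consecutive standard
words, normalised by length, agree. -/
def logCross (A : Fin 2 → Mat) (γ : ℝ) (n : ℕ) : ℝ :=
  (-1) ^ n * (contDen (cfCoeff γ) (n + 1) * Real.log (rhoSeq A γ (n + 1)) -
    contDen (cfCoeff γ) n * Real.log (rhoSeq A γ (n + 2)))

theorem logCross_succ_sub (A : Fin 2 → Mat) (γ : ℝ) (n : ℕ) :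
    logCross A γ (n + 1) - logCross A γ n = (-1) ^ (n + 1) * contDen (cfCoeff γ) (n + 1) *
      (cfCoeff γ (n + 2) * Real.log (rhoSeq A γ (n + 2)) + Real.log (rhoSeq A γ (n + 1)) -
        Real.log (rhoSeq A γ (n + 3))) := by
  simp only [logCross, contDen]
  push_cast
  ring

/-- If a non-negative null sequence `h` has increments `(-1) ^ n * d n / (q n * q (n + 1))` with `q`
growing at least geometrically and `d` convergent, then the limit of `d` vanishes. -/
theorem eq_zero_of_alternating_increments {h d q : ℕ → ℝ} {D : ℝ} (hq : ∀ n, 0 < q n)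
    (hq2 : ∀ n, 2 * q n ≤ q (n + 2)) (hh : ∀ᶠ n in atTop, 0 ≤ h n)
    (hh0 : Tendsto h atTop (𝓝 0)) (hd : Tendsto d atTop (𝓝 D))
    (hinc : ∀ n, h (n + 1) - h n = (-1) ^ n * d n / (q n * q (n + 1))) : D = 0 := by
  by_contra hD
  have hDp : 0 < |D| := abs_pos.2 hD
  obtain ⟨N, hN⟩ := eventually_atTop.1
    (hh.and ((Metric.tendsto_nhds.1 hd) (|D| / 4) (by positivity)))
  -- The parity on which the increment of h has the sign making h grow.
  obtain ⟨e, he⟩ : ∃ e : ℕ, ((-1 : ℝ) ^ e) * D = |D| := by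
    rcases lt_or_gt_of_ne hD with h1 | h1
    · exact ⟨1, by rw [abs_of_neg h1]; ring⟩
    · exact ⟨0, by rw [abs_of_pos h1]; ring⟩
  have hsgn : ∀ m : ℕ, ((-1 : ℝ) ^ (2 * m + e)) = (-1) ^ e := fun m => by
    rw [pow_add, pow_mul]; simp
  have habs : |(-1 : ℝ) ^ e| = 1 := by simp
  have hstep : ∀ m, N ≤ m → h (2 * m + e) < h (2 * (m + 1) + e) := by
    intro m hm
    set n := 2 * m + e with hn
    have e1 : 2 * (m + 1) + e = n + 2 := by omega
    rw [e1]
    have hs : (-1 : ℝ) ^ n = (-1) ^ e := hsgn m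
    have i1 := hinc n
    have i2 := hinc (n + 1)
    rw [pow_succ, hs] at i2
    rw [hs] at i1
    have b1 := (hN n (by omega)).2
    have b2 := (hN (n + 1) (by omega)).2
    rw [Real.dist_eq] at b1 b2
    have c1 : abs ((-1 : ℝ) ^ e * d n - |D|) < |D| / 4 := by
      rw [← he, ← mul_sub, abs_mul, habs, one_mul]; rwa [he]
    have c2 : abs ((-1 : ℝ) ^ e * d (n + 1) - |D|) < |D| / 4 := by
      rw [← he, ← mul_sub, abs_mul, habs, one_mul]; rwa [he]
    rw [abs_lt] at c1 c2
    have q0 := hq n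
    have q1 := hq (n + 1)
    have q2 := hq (n + 2)
    have e2 : h (n + 2) - h n = ((-1) ^ e * d n * q (n + 2) - (-1) ^ e * d (n + 1) * q n) /
        (q n * q (n + 1) * q (n + 2)) := by
      have : h (n + 2) - h n = (h (n + 1 + 1) - h (n + 1)) + (h (n + 1) - h n) := by ring
      rw [this, i1, i2]
      field_simp
      ring
    have e3 : 0 < h (n + 2) - h n := by
      rw [e2]
      refine div_pos ?_ (by positivity)
      -- The gain is at least (3/2)|D| q n and the following loss at most (5/4)|D| q n; the doubling
      -- of q over two steps makes the gain win.
      have f1 : 3 / 4 * |D| * (2 * q n) ≤ (-1) ^ e * d n * q (n + 2) :=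
        mul_le_mul (by linarith) (hq2 n) (by positivity) (by linarith)
      have f2 : (-1) ^ e * d (n + 1) * q n ≤ 5 / 4 * |D| * q n :=
        mul_le_mul_of_nonneg_right (by linarith) q0.le
      have f3 : 0 < |D| * q n := by positivity
      linarith
    linarith
  have hmono : ∀ j, h (2 * (N + 1) + e) ≤ h (2 * (N + 1 + j) + e) := fun j => by
    induction j with
    | zero => exact le_rfl
    | succ j ih => exact ih.trans (hstep (N + 1 + j) (by omega)).le
  have hlim : Tendsto (fun j => h (2 * (N + 1 + j) + e)) atTop (𝓝 0) :=
    hh0.comp (tendsto_atTop_mono (fun j => (by omega : j ≤ 2 * (N + 1 + j) + e)) tendsto_id)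
  have h1 := ge_of_tendsto' hlim hmono
  have h2 := hstep N le_rfl
  have h3 := (hN (2 * N + e) (by omega)).1
  linarith

/-! ### Convergence of the crossing parameters and identification of the limit -/

section Technical

variable {A : Fin 2 → Mat} (hA : TechnicalHypotheses A)

include hA

theorem wordProd_stdWord_pos {a : ℕ → ℕ} (ha : ∀ n, 1 ≤ a (n + 1)) (n : ℕ) :
    ∀ i j, 0 < wordProd A (stdWord a (n + 3)) i j :=
  wordProd_pos_of_mem hA (mem_stdWord ha n).1 (mem_stdWord ha n).2

theorem rho_pos_of_letter (k : Fin 2) : 0 < rho (A k) := rho_pos (hA.nonneg k) (hA.trace_pos k)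

theorem rho_pos_of_mem {u : Word} (h0 : 0 ∈ u) (h1 : 1 ∈ u) : 0 < rho (wordProd A u) := by
  have := wordProd_pos_of_mem hA h0 h1
  exact rho_pos (fun i j => (this i j).le) (by
    rw [Matrix.trace_fin_two]; exact add_pos (this _ _) (this _ _))

theorem rhoSeq_pos {γ : ℝ} (hγ : Irrational γ) : ∀ n, 0 < rhoSeq A γ n
  | 0 => by simpa [rhoSeq, stdWord] using rho_pos_of_letter hA 1
  | 1 => by simpa [rhoSeq, stdWord] using rho_pos_of_letter hA 0
  | 2 => by
    rcases Nat.eq_zero_or_pos (cfCoeff γ 1 - 1) with h | h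
    · simpa [rhoSeq, stdWord, h, wordPow] using rho_pos_of_letter hA 1
    · exact rho_pos_of_mem hA (List.mem_append_left _ (mem_wordPow (by simp) h)) (by simp [stdWord])
  | n + 3 => rho_pos_of_mem hA (mem_stdWord (one_le_cfCoeff hγ) n).1
      (mem_stdWord (one_le_cfCoeff hγ) n).2

/-- The contraction coefficient is submultiplicative and word lengths add, so a rate κ per letter
valid for two consecutive standard words passes to all later ones. -/
theorem exists_abs_det_stdWord_le {a : ℕ → ℕ} (ha : ∀ n, 1 ≤ a (n + 1)) :
    ∃ κ : ℝ, 0 < κ ∧ κ < 1 ∧ ∀ n, |(wordProd A (stdWord a (n + 3))).det| ≤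
      κ ^ contDen a (n + 2) * per (wordProd A (stdWord a (n + 3))) := by
  have hpos := wordProd_stdWord_pos hA ha
  have hnn : ∀ n i j, 0 ≤ wordProd A (stdWord a (n + 3)) i j := fun n i j => (hpos n i j).le
  obtain ⟨κ₀, h00, h01, h0⟩ := exists_abs_det_le (hpos 0) (contDen_pos ha 2)
  obtain ⟨κ₁, h10, h11, h1⟩ := exists_abs_det_le (hpos 1) (contDen_pos ha 3)
  have hκ : 0 < max κ₀ κ₁ := lt_max_of_lt_left h00
  refine ⟨max κ₀ κ₁, hκ, max_lt h01 h11, fun n => ?_⟩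
  induction n using Nat.twoStepInduction with
  | zero =>
    exact h0.trans (mul_le_mul_of_nonneg_right (pow_le_pow_left₀ h00.le (le_max_left _ _) _)
      (per_nonneg (hnn 0)))
  | one =>
    exact h1.trans (mul_le_mul_of_nonneg_right (pow_le_pow_left₀ h10.le (le_max_right _ _) _)
      (per_nonneg (hnn 1)))
  | more n ih1 ih2 =>
    have hp := abs_det_pow_le (hnn (n + 1)) (pow_nonneg hκ.le _) ih2 (a (n + 4))
    have := abs_det_mul_le (hnn n) hp.1 (pow_nonneg hκ.le _) ih1
      (pow_nonneg (pow_nonneg hκ.le _) _) hp.2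
    rw [wordProd_stdWord_succ]
    refine this.trans_eq ?_
    congr 1
    rw [← pow_mul, ← pow_add]
    congr 1
    change _ = a (n + 4) * contDen a (n + 3) + contDen a (n + 2)
    ring

theorem rhoSeq_comparison {γ : ℝ} (hγ : Irrational γ) {b : ℝ} (hb0 : 0 ≤ b) (hb1 : b < 1) (n : ℕ)
    (hdet : |(wordProd A (stdWord (cfCoeff γ) (n + 4))).det| ≤
      b * per (wordProd A (stdWord (cfCoeff γ) (n + 4)))) :
    |cfCoeff γ (n + 4) * Real.log (rhoSeq A γ (n + 4)) + Real.log (rhoSeq A γ (n + 3)) -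
        Real.log (rhoSeq A γ (n + 5))| ≤ 2 * b / (1 - b) := by
  set a := cfCoeff γ with ha_def
  have ha : ∀ n, 1 ≤ a (n + 1) := one_le_cfCoeff hγ
  -- Each of these standard words begins with its predecessor, so s_{n+2}^{a_{n+3}+1} begins with
  -- s_{n+3}; products reverse order, hence the factor on the right.
  have hfac : wordProd A (stdWord a (n + 3)) ^ (a (n + 3) + 1) =
      wordProd A (wordPow (stdWord a (n + 2)) (a (n + 2) - 1) ++ stdWord a (n + 1)) *
        wordProd A (stdWord a (n + 4)) := by
    have e : stdWord a (n + 3) = stdWord a (n + 2) ++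
        (wordPow (stdWord a (n + 2)) (a (n + 2) - 1) ++ stdWord a (n + 1)) := by
      rw [← List.append_assoc, ← wordPow_succ, Nat.sub_add_cancel (ha _)]
      rfl
    rw [wordProd_stdWord_succ A a (n + 1), ← mul_assoc, ← wordProd_append, ← e, ← pow_succ']
  have hcomp := rho_mul_pow_comparison (wordProd_stdWord_pos hA ha (n + 1))
    (wordProd_stdWord_pos hA ha n) (wordProd_nonneg hA.nonneg _) hfac hb0 hb1 hdet (a (n + 4))
    (by rw [← wordProd_stdWord_succ A a (n + 2)]; exact wordProd_stdWord_pos hA ha (n + 2))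
  rw [← wordProd_stdWord_succ A a (n + 2)] at hcomp
  have r3 := rhoSeq_pos hA hγ (n + 3)
  have r4 := rhoSeq_pos hA hγ (n + 4)
  have r5 := rhoSeq_pos hA hγ (n + 5)
  have e3 : rho (wordProd A (stdWord a (n + 3))) = rhoSeq A γ (n + 3) := rfl
  have e4 : rho (wordProd A (stdWord a (n + 4))) = rhoSeq A γ (n + 4) := rfl
  have e5 : rho (wordProd A (stdWord a (n + 2 + 3))) = rhoSeq A γ (n + 5) := rfl
  rw [e3, e4, e5] at hcomp
  generalize rhoSeq A γ (n + 3) = x at hcomp r3 ⊢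
  generalize rhoSeq A γ (n + 4) = y at hcomp r4 ⊢
  generalize rhoSeq A γ (n + 5) = z at hcomp r5 ⊢
  have hb : 0 < 1 - b := by linarith
  have hK : 0 < (1 + b) / (1 - b) := by positivity
  have hlogK : Real.log ((1 + b) / (1 - b)) ≤ 2 * b / (1 - b) := by
    refine (Real.log_le_sub_one_of_pos hK).trans_eq ?_
    field_simp
    ring
  have l1 := Real.log_le_log r5 hcomp.1
  have l2 := Real.log_le_log (by positivity) hcomp.2
  rw [Real.log_mul hK.ne' (by positivity), Real.log_mul (by positivity) r3.ne', Real.log_pow] at l1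
  rw [Real.log_mul hK.ne' r5.ne', Real.log_mul (by positivity) r3.ne', Real.log_pow] at l2
  rw [abs_le]
  constructor <;> linarith

theorem exists_tendsto_logCross {γ : ℝ} (hγ : Irrational γ) :
    ∃ τ, Tendsto (logCross A γ) atTop (𝓝 τ) := by
  have ha := one_le_cfCoeff hγ
  obtain ⟨κ, hκ0, hκ1, hdet⟩ := exists_abs_det_stdWord_le hA ha
  have hsum : Summable fun n : ℕ => 2 / (1 - κ) *
      ((contDen (cfCoeff γ) (n + 3) : ℝ) ^ 1 * κ ^ contDen (cfCoeff γ) (n + 3)) := by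
    refine Summable.mul_left _ ?_
    have h1 : Summable fun n : ℕ => (n : ℝ) ^ 1 * κ ^ n :=
      summable_pow_mul_geometric_of_norm_lt_one 1 (by
        rw [Real.norm_eq_abs, abs_of_pos hκ0]; exact hκ1)
    -- The denominators are strictly increasing, so this is a subseries of Σ m κ^m.
    exact h1.comp_injective (i := fun n => contDen (cfCoeff γ) (n + 3))
      ((strictMono_contDen ha).injective.comp (add_left_injective 2))
  have hcau : CauchySeq fun n => logCross A γ (n + 2) := by
    refine cauchySeq_of_dist_le_of_summable _ (fun n => ?_) hsum
    rw [dist_comm, Real.dist_eq, Nat.succ_eq_add_one, show n + 1 + 2 = n + 2 + 1 by ring,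
      logCross_succ_sub]
    set q := contDen (cfCoeff γ) (n + 3) with hq
    have hqp : 1 ≤ q := contDen_pos ha _
    have hb1 : κ ^ q ≤ κ := pow_le_of_le_one hκ0.le hκ1.le (by omega)
    have hb0 : 0 ≤ κ ^ q := by positivity
    have := rhoSeq_comparison hA hγ hb0 (by linarith) n (hdet (n + 1))
    rw [abs_mul, abs_mul, abs_pow, abs_neg, abs_one, one_pow, one_mul, Nat.abs_cast]
    have h2 : 2 * κ ^ q / (1 - κ ^ q) ≤ 2 * κ ^ q / (1 - κ) :=
      div_le_div_of_nonneg_left (by positivity) (by linarith) (by linarith)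
    calc _ ≤ (q : ℝ) * (2 * κ ^ q / (1 - κ)) :=
          mul_le_mul_of_nonneg_left (this.trans h2) (by positivity)
      _ = _ := by ring
  obtain ⟨τ, hτ⟩ := cauchySeq_tendsto_of_complete hcau
  exact ⟨τ, (tendsto_add_atTop_iff_nat 2).1 hτ⟩

/-- With a positive first block, the trace of the product, hence twice its spectral radius,
dominates a multiple of the norm of the remaining factor. -/
theorem exists_nrm_le_rho {u : Word} (h0 : 0 ∈ u) (h1 : 1 ∈ u) :
    ∃ C, ∀ v, Real.log (nrm (wordProd A (u ++ v))) - C ≤ Real.log (rho (wordProd A (u ++ v))) := by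
  have hpos := wordProd_pos_of_mem hA h0 h1
  obtain ⟨c, hc, hle⟩ := exists_pos_le_entries hpos
  have hB := nrm_wordProd_pos hA u
  refine ⟨Real.log (2 * nrm (wordProd A u) / c), fun v => ?_⟩
  have hV := wordProd_nonneg hA.nonneg v
  have hρ : 0 < rho (wordProd A (u ++ v)) :=
    rho_pos_of_mem hA (List.mem_append_left _ h0) (List.mem_append_left _ h1)
  rw [sub_le_iff_le_add', ← Real.log_mul (by positivity) hρ.ne']
  refine Real.log_le_log (nrm_wordProd_pos hA _) ?_
  have h2 := half_trace_le_rho (wordProd_nonneg hA.nonneg (u ++ v))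
  have h3 : c * entrySum (wordProd A v) ≤
      wordProd A (u ++ v) 0 0 + wordProd A (u ++ v) 1 1 := by
    rw [wordProd_append, entrySum, Matrix.mul_apply, Matrix.mul_apply, Fin.sum_univ_two,
      Fin.sum_univ_two]
    linarith [mul_le_mul_of_nonneg_left (hle 0 0) (hV 0 0),
      mul_le_mul_of_nonneg_left (hle 1 0) (hV 0 1),
      mul_le_mul_of_nonneg_left (hle 0 1) (hV 1 0), mul_le_mul_of_nonneg_left (hle 1 1) (hV 1 1)]
  have h4 := mul_le_mul_of_nonneg_left (nrm_le_entrySum hV) hc.le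
  have h5 : nrm (wordProd A v) ≤ 2 * rho (wordProd A (u ++ v)) / c := by
    rw [le_div_iff₀ hc]
    linarith
  calc nrm (wordProd A (u ++ v)) ≤ nrm (wordProd A v) * nrm (wordProd A u) := by
        rw [wordProd_append]; exact nrm_mul_le _ _
    _ ≤ 2 * rho (wordProd A (u ++ v)) / c * nrm (wordProd A u) :=
        mul_le_mul_of_nonneg_right h5 hB.le
    _ = _ := by ring

variable {r : ℝ≥0 → Set.Icc (0 : ℝ) 1} (hr : IsOneRatioFunction A r)

include hr

/-- A parameter with irrational one-ratio is the limit of the crossing parameters. -/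
theorem eq_of_ratio_eq {γ : ℝ} (h0 : 0 < γ) (h1 : γ < 1) (hγ : Irrational γ) {t τ : ℝ}
    (ht : (r (expNN t) : ℝ) = γ) (hτ : Tendsto (logCross A γ) atTop (𝓝 τ)) : t = τ := by
  have ha := one_le_cfCoeff hγ
  have hqpos : ∀ n, (0 : ℝ) < contDen (cfCoeff γ) n := fun n => by
    exact_mod_cast contDen_pos ha n
  set ℓ : ℕ → ℝ := fun n => (Real.log (rhoSeq A γ (n + 1)) + t * contNum (cfCoeff γ) n) /
    contDen (cfCoeff γ) n with hℓ
  have hle : ∀ᶠ n in atTop, ℓ n ≤ logJSR A t := by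
    filter_upwards [eventually_ge_atTop 2] with n hn
    obtain ⟨m, rfl⟩ : ∃ m, n = m + 2 := ⟨n - 2, by omega⟩
    have hne : stdWord (cfCoeff γ) (m + 3) ≠ [] := List.ne_nil_of_mem (mem_stdWord ha m).1
    have := le_logJSR_of_pow_le hA hne (rhoSeq_pos hA hγ (m + 3))
      (rho_pow_le_nrm (wordProd_stdWord_pos hA ha m)) t
    rw [count_stdWord, length_stdWord hγ h0 h1] at this
    simp only [hℓ]
    rw [div_le_iff₀' (hqpos _)]
    exact this
  -- All later standard words share the positive prefix s_2, so norm and spectral radius differ by a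
  -- bounded factor; extremality of `mech` then gives the lower bound.
  have hlim : Tendsto ℓ atTop (𝓝 (logJSR A t)) := by
    obtain ⟨C, hC⟩ := exists_nrm_le_rho hA (mem_stdWord ha 0).1 (mem_stdWord ha 0).2
    have hx : WeaklyExtremal (scaledPair A (expNN t)) (mech γ) :=
      hr.weaklyExtremal _ _ (by rw [ht]; exact mech_mem_sturmianSet h0.le h1.le)
    rw [weaklyExtremal_iff_tendsto hA] at hx
    have hqtop : Tendsto (fun n => contDen (cfCoeff γ) n) atTop atTop :=
      (tendsto_add_atTop_iff_nat 1).1 (strictMono_contDen ha).tendsto_atTop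
    have hqtop' : Tendsto (fun n => (contDen (cfCoeff γ) n : ℝ)) atTop atTop :=
      tendsto_natCast_atTop_atTop.comp hqtop
    have hlow := (hx.comp hqtop).sub (hqtop'.const_div_atTop C)
    rw [sub_zero] at hlow
    refine tendsto_of_tendsto_of_tendsto_of_le_of_le' hlow tendsto_const_nhds ?_ hle
    filter_upwards [eventually_ge_atTop 2] with n hn
    obtain ⟨m, rfl⟩ : ∃ m, n = m + 2 := ⟨n - 2, by omega⟩
    have hq2 : contDen (cfCoeff γ) 2 ≤ contDen (cfCoeff γ) (m + 2) :=
      (strictMono_contDen ha).monotone (by omega : 1 ≤ m + 1)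
    obtain ⟨k, hk⟩ := Nat.exists_eq_add_of_le hq2
    have hsplit : stdWord (cfCoeff γ) (m + 3) = stdWord (cfCoeff γ) (0 + 3) ++
        pre (fun i => mech γ (contDen (cfCoeff γ) 2 + i)) k := by
      rw [← pre_mech hγ h0 h1 (m + 1), ← pre_mech hγ h0 h1 (0 + 1), ← pre_add]
      exact congrArg _ hk
    have hCk := hC (pre (fun i => mech γ (contDen (cfCoeff γ) 2 + i)) k)
    rw [← hsplit] at hCk
    simp only [Function.comp_apply, hℓ, logNrm]
    rw [pre_mech hγ h0 h1 (m + 1), ← sub_div, count_stdWord]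
    refine div_le_div_of_nonneg_right ?_ (hqpos _).le
    change _ ≤ Real.log (rho (wordProd A (stdWord (cfCoeff γ) (m + 3)))) + _
    linarith
  have hD : τ - t = 0 := by
    refine eq_zero_of_alternating_increments (h := fun n => logJSR A t - ℓ n)
      (d := fun n => logCross A γ n - t) (q := fun n => contDen (cfCoeff γ) n) hqpos
      (fun n => by exact_mod_cast two_mul_contDen_le ha n) (hle.mono fun n hn => sub_nonneg.2 hn)
      (by simpa using hlim.const_sub (logJSR A t)) (hτ.sub_const t) fun n => ?_
    have hdet : (contNum (cfCoeff γ) (n + 1) : ℝ) * contDen (cfCoeff γ) n -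
        contNum (cfCoeff γ) n * contDen (cfCoeff γ) (n + 1) = (-1) ^ n := by
      exact_mod_cast contNum_mul_contDen_sub (cfCoeff γ) n
    have hsq : (-1 : ℝ) ^ n * (-1) ^ n = 1 := by rw [← mul_pow]; simp
    have q0 := (hqpos n).ne'
    have q1 := (hqpos (n + 1)).ne'
    simp only [hℓ, logCross]
    rw [sub_sub_sub_cancel_left, div_sub_div _ _ q0 q1, mul_sub, ← mul_assoc, hsq, one_mul, ← hdet]
    congr 1
    ring
  linarith

end Technical

theorem zpow_eq_exp {x : ℝ} (hx : 0 < x) (k : ℤ) : x ^ k = Real.exp (k * Real.log x) := by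
  rw [← Real.log_zpow, Real.exp_log (zpow_pos hx k)]

theorem cross_eq_exp {A : Fin 2 → Mat} {γ : ℝ} (hρ : ∀ n, 0 < rhoSeq A γ n) (n : ℕ) :
    (rhoSeq A γ (n + 1) ^ contDen (cfCoeff γ) (n + 1) /
      rhoSeq A γ (n + 2) ^ contDen (cfCoeff γ) n) ^ ((-1 : ℤ) ^ n) =
      Real.exp (logCross A γ n) := by
  have h1 := hρ (n + 1)
  have h2 := hρ (n + 2)
  rw [zpow_eq_exp (by positivity), Real.log_div (by positivity) (by positivity), Real.log_pow,
    Real.log_pow, logCross]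
  push_cast
  rfl

/-- The factor n = 0 cancels 1/ρ(A_1) and leaves ρ_0^{q_1}/ρ_1; each later factor is the exponential
of an increment of `logCross`. -/
theorem prod_eq_exp {A : Fin 2 → Mat} {γ : ℝ} (hρ : ∀ n, 0 < rhoSeq A γ n) (N : ℕ) :
    1 / rho (A 1) * ∏ n ∈ Finset.range (N + 1),
      (rhoSeq A γ (n + 1) ^ cfCoeff γ (n + 1) * rhoSeq A γ n / rhoSeq A γ (n + 2)) ^
        ((-1 : ℤ) ^ n * (contDen (cfCoeff γ) n : ℤ)) = Real.exp (logCross A γ N) := by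
  induction N with
  | zero =>
    have h0 := hρ 0
    have h1 := hρ 1
    have h2 := hρ 2
    have e : rho (A 1) = rhoSeq A γ 0 := by simp [rhoSeq, stdWord]
    have hc := cross_eq_exp hρ 0
    simp only [contDen, zero_add, pow_zero, zpow_one, pow_one] at hc
    rw [e, ← hc]
    simp [contDen]
    field_simp
  | succ N ih =>
    rw [Finset.prod_range_succ, ← mul_assoc, ih]
    have h1 := hρ (N + 1)
    have h2 := hρ (N + 2)
    have h3 := hρ (N + 3)
    rw [zpow_eq_exp (by positivity), ← Real.exp_add, Real.log_div (by positivity) (by positivity),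
      Real.log_mul (by positivity) (by positivity), Real.log_pow]
    congr 1
    have := logCross_succ_sub A γ N
    push_cast
    linarith

end DevilStaircase

end

theorem theorem2p5 (A : Fin 2 → DevilStaircase.Mat)
    (hA : DevilStaircase.TechnicalHypotheses A)
    (r : ℝ≥0 → Set.Icc (0 : ℝ) 1) (hr : DevilStaircase.IsOneRatioFunction A r)
    (γ : ℝ) (hγ0 : 0 < γ) (hγ1 : γ < 1) (hγ : Irrational γ) :
    ∃ α : ℝ≥0, 0 < α ∧ {β : ℝ≥0 | (r β : ℝ) = γ} = {α} ∧
      Filter.Tendsto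
        (fun n : ℕ =>
          (DevilStaircase.rhoSeq A γ (n + 1) ^ DevilStaircase.cfDen γ (n + 1) /
            DevilStaircase.rhoSeq A γ (n + 2) ^ DevilStaircase.cfDen γ n) ^ ((-1 : ℤ) ^ n))
        Filter.atTop (𝓝 (α : ℝ)) ∧
      Filter.Tendsto
        (fun N : ℕ =>
          1 / DevilStaircase.rho (A 1) *
            ∏ n ∈ Finset.range N,
              (DevilStaircase.rhoSeq A γ (n + 1) ^ DevilStaircase.cfCoeff γ (n + 1) *
                  DevilStaircase.rhoSeq A γ n /
                DevilStaircase.rhoSeq A γ (n + 2)) ^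
                ((-1 : ℤ) ^ n * (DevilStaircase.cfDen γ n : ℤ)))
        Filter.atTop (𝓝 (α : ℝ)) := by
  obtain ⟨τ, hτ⟩ := DevilStaircase.exists_tendsto_logCross hA hγ
  obtain ⟨t, ht⟩ := DevilStaircase.exists_ratio_eq hA hr hγ0 hγ1
  obtain rfl := DevilStaircase.eq_of_ratio_eq hA hr hγ0 hγ1 hγ ht hτ
  have hρ := DevilStaircase.rhoSeq_pos hA hγ
  have hexp := (Real.continuous_exp.tendsto t).comp hτ
  simp only [DevilStaircase.cfDen_eq_contDen hγ hγ0 hγ1]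
  refine ⟨DevilStaircase.expNN t, Real.exp_pos t, ?_, ?_, ?_⟩
  · refine Set.eq_singleton_iff_unique_mem.2 ⟨ht, fun β hβ => ?_⟩
    have hβ' : (r β : ℝ) = γ := hβ
    -- The logarithmic parametrisation misses 0, where the ratio is 0 and not γ.
    have hβ0 : β ≠ 0 := by
      rintro rfl
      rw [DevilStaircase.ratio_zero hA hr] at hβ'
      exact hγ0.ne hβ'
    have e : β = DevilStaircase.expNN (Real.log β) := by
      ext
      rw [DevilStaircase.coe_expNN, Real.exp_log (NNReal.coe_pos.2 (pos_iff_ne_zero.2 hβ0))]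
    rw [e] at hβ'
    rw [e, DevilStaircase.eq_of_ratio_eq hA hr hγ0 hγ1 hγ hβ' hτ]
  · exact hexp.congr fun n => (DevilStaircase.cross_eq_exp hρ n).symm
  · rw [← Filter.tendsto_add_atTop_iff_nat 1]
    exact hexp.congr fun n => (DevilStaircase.prod_eq_exp hρ n).symm
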